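/- All graphs are finite and simple. Let $G=(V,E)$ be a connected graph with $n=|V|$ and $m=|E|$. Let $N[v]$ denote the closed neighbourhood of $v$, let $d$ be the graph distance, and let $e(v)=\max_{w\in V}d(v,w)$ be the eccentricity of $v$. A *module* of $G$ is a set $M\subseteq V$ with $N(x)\setminus M=N(y)\setminus M$ for all $x,y\in M$; $G$ is *prime* if its only modules are $\emptyset$, $V$ and the singletons. A module is *strong* if for every module $M'$ either one of the two contains the other or they are disjoint. The *quotient graph* of $G$ has as vertices the inclusionwise maximal strong modules different from $V$, two of them being adjacent if every vertex of one is adjacent to every vertex of the other. An *extremity* of a connected graph is a vertex $v$ such that the graph obtained by deleting $N[v]$ has at most one connected component. $Ext_\alpha$ is the class of connected graphs whose quotient graph has no more than $\alpha$ pairwise nonadjacent extremities. **Lemma.** There is a deterministic algorithm with the following property. Given the adjacency lists of a connected prime graph $G=(V,E)$ and a vertex $u\in V$, it computes $$\ell(u)=\max\{e(x) : x\in N[u]\}$$ together with a vertex $x\in N[u]$ such that $e(x)=\ell(u)$. If $q$ is the number of extremities of $G$, then its running time is ${\cal O}(qm)$; moreover, for every $\alpha \in \mathbb{N}$ such that $G\in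 Ext_\alpha$, its running time is ${\cal O}(\alpha m^{3/2})$. (For the one-vertex graph, where $m=0$, these bounds are read as ${\cal O}(1)$.) The constants are absolute, and neither $q$ nor $\alpha$ is part of the input. Running time is the number of unit-cost operations (loading a constant, a register or an array cell, storing, addition, truncated subtraction, comparison, and the evaluation of logical connectives in branching and loop conditions) of a fixed word-RAM program with words of ${\cal O}(\log(n+2))$ bits, started on adjacency lists in arbitrary order. -/

import Mathlib

namespace SearchDiam

section Graphs

variable {V : Type*}

/-- The closed neighbourhood `N[v]`. -/
def closedNbhd (G : SimpleGraph V) (v : V) : Set V := insert v (G.neighborSet v)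

/-- A module: any two of its vertices have the same neighbours outside it. -/
def IsModule (G : SimpleGraph V) (M : Set V) : Prop :=
  ∀ x ∈ M, ∀ y ∈ M, G.neighborSet x \ M = G.neighborSet y \ M

/-- A graph is prime if its only modules are `∅`, the whole vertex set and the singletons. -/
def IsPrime (G : SimpleGraph V) : Prop :=
  ∀ M : Set V, IsModule G M → M = ∅ ∨ M = Set.univ ∨ ∃ v, M = {v}

/-- A strong module: a module that overlaps no other module. -/
def IsStrongModule (G : SimpleGraph V) (M : Set V) : Prop :=
  IsModule G M ∧ ∀ M' : Set V, IsModule G M' → M ⊆ M' ∨ M' ⊆ M ∨ Disjoint M M'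

/-- The inclusionwise maximal strong modules that are not the whole vertex set. -/
def maxStrongModules (G : SimpleGraph V) : Set (Set V) :=
  {M | Maximal (fun M : Set V => IsStrongModule G M ∧ M ≠ Set.univ) M}

/-- The quotient graph: `M` and `M'` are adjacent when all of `M` is adjacent to all of `M'`. -/
def quotientGraph (G : SimpleGraph V) : SimpleGraph (maxStrongModules G) where
  Adj M M' := M ≠ M' ∧ ∀ x ∈ M.1, ∀ y ∈ M'.1, G.Adj x y
  symm := ⟨fun _ _ h => ⟨h.1.symm, fun x hx y hy => (h.2 y hy x hx).symm⟩⟩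
  loopless := ⟨fun _ h => h.1 rfl⟩

/-- An extremity of a connected graph: deleting `N[v]` leaves at most one connected component
(so the deletion does not increase the number of components). -/
def IsExtremity (G : SimpleGraph V) (v : V) : Prop :=
  (G.induce (closedNbhd G v)ᶜ).Preconnected

/-- The number of extremities of a (finite) graph. -/
noncomputable def numExtremities (G : SimpleGraph V) : ℕ := {v | IsExtremity G v}.ncard

/-- The number of edges of a (finite) graph. -/
noncomputable def numEdges (G : SimpleGraph V) : ℕ := G.edgeSet.ncard

/-- The class `Ext_α`: connected graphs whose quotient graph has no more than `α` pairwise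
nonadjacent extremities. -/
def InExt (α : ℕ) (G : SimpleGraph V) : Prop :=
  G.Connected ∧ ∀ S : Set (maxStrongModules G),
    (∀ M ∈ S, IsExtremity (quotientGraph G) M) → (quotientGraph G).IsIndepSet S →
      S.encard ≤ α

/-- `ℓ(u)`, the largest eccentricity of a vertex of `N[u]`. -/
noncomputable def ell (G : SimpleGraph V) (u : V) : ℕ∞ :=
  ⨆ x ∈ closedNbhd G u, G.eccent x

end Graphs

/-!
A word RAM, programmed in structured form. The memory consists of scalar registers and of
arrays of words, both numbered by constants of the program (so a program uses finitely many of
each). The operations are: load a constant, a register, or an array cell at a computed address;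
addition; truncated subtraction; comparison. Each of them, and each store, takes one unit of time.
A run is defined only while every value that is computed, addresses included, is below the
word bound `W`.
-/

/-- The contents of the registers and of the arrays. -/
structure State where
  reg : ℕ → ℕ
  arr : ℕ → ℕ → ℕ

/-- Store the value `k` in register `x`. -/
def State.setReg (s : State) (x k : ℕ) : State :=
  ⟨Function.update s.reg x k, s.arr⟩

/-- Store the value `k` in cell `i` of array `a`. -/
def State.setArr (s : State) (a i k : ℕ) : State :=
  ⟨s.reg, Function.update s.arr a (Function.update (s.arr a) i k)⟩

inductive Expr where
  | lit (k : ℕ)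
  | reg (x : ℕ)
  | read (a : ℕ) (i : Expr)
  | add (e f : Expr)
  | sub (e f : Expr)

/-- The value of an expression. -/
def Expr.val (s : State) : Expr → ℕ
  | .lit k => k
  | .reg x => s.reg x
  | .read a i => s.arr a (i.val s)
  | .add e f => e.val s + f.val s
  | .sub e f => e.val s - f.val s

/-- The number of operations needed to evaluate an expression. -/
def Expr.cost : Expr → ℕ
  | .lit _ => 1
  | .reg _ => 1
  | .read _ i => i.cost + 1
  | .add e f => e.cost + f.cost + 1
  | .sub e f => e.cost + f.cost + 1

/-- Every value that occurs in the evaluation of the expression is below `W`. -/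
def Expr.Fits (W : ℕ) (s : State) : Expr → Prop
  | .lit k => k < W
  | .reg x => s.reg x < W
  | .read a i => i.Fits W s ∧ s.arr a (i.val s) < W
  | .add e f => e.Fits W s ∧ f.Fits W s ∧ e.val s + f.val s < W
  | .sub e f => e.Fits W s ∧ f.Fits W s

inductive Test where
  | lt (e f : Expr)
  | eq (e f : Expr)
  | not (b : Test)
  | and (b c : Test)

def Test.Holds (s : State) : Test → Prop
  | .lt e f => e.val s < f.val s
  | .eq e f => e.val s = f.val s
  | .not b => ¬ b.Holds s
  | .and b c => b.Holds s ∧ c.Holds s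

def Test.cost : Test → ℕ
  | .lt e f => e.cost + f.cost + 1
  | .eq e f => e.cost + f.cost + 1
  | .not b => b.cost + 1
  | .and b c => b.cost + c.cost + 1

def Test.Fits (W : ℕ) (s : State) : Test → Prop
  | .lt e f => e.Fits W s ∧ f.Fits W s
  | .eq e f => e.Fits W s ∧ f.Fits W s
  | .not b => b.Fits W s
  | .and b c => b.Fits W s ∧ c.Fits W s

/-- Programs. -/
inductive Prog where
  | nop
  | setReg (x : ℕ) (e : Expr)
  | setArr (a : ℕ) (i e : Expr)
  | seq (p q : Prog)
  | cond (b : Test) (p q : Prog)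
  | loop (b : Test) (p : Prog)

/-- `Run W p s t s'`: with word bound `W`, the program `p` started in the state `s` halts in the
state `s'` after exactly `t` units of time. -/
inductive Run (W : ℕ) : Prog → State → ℕ → State → Prop where
  | nop (s : State) : Run W .nop s 1 s
  | setReg (s : State) (x : ℕ) (e : Expr) : e.Fits W s →
      Run W (.setReg x e) s (e.cost + 1) (s.setReg x (e.val s))
  | setArr (s : State) (a : ℕ) (i e : Expr) : i.Fits W s → e.Fits W s →
      Run W (.setArr a i e) s (i.cost + e.cost + 1) (s.setArr a (i.val s) (e.val s))
  | seq {p q : Prog} {s s' s'' : State} {t t' : ℕ} : Run W p s t s' → Run W q s' t' s'' →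
      Run W (.seq p q) s (t + t') s''
  | cond_true {b : Test} {p q : Prog} {s s' : State} {t : ℕ} : b.Fits W s → b.Holds s →
      Run W p s t s' → Run W (.cond b p q) s (b.cost + t) s'
  | cond_false {b : Test} {p q : Prog} {s s' : State} {t : ℕ} : b.Fits W s → ¬ b.Holds s →
      Run W q s t s' → Run W (.cond b p q) s (b.cost + t) s'
  | loop_done {b : Test} {p : Prog} {s : State} : b.Fits W s → ¬ b.Holds s →
      Run W (.loop b p) s b.cost s
  | loop_step {b : Test} {p : Prog} {s s' s'' : State} {t t' : ℕ} : b.Fits W s → b.Holds s →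
      Run W p s t s' → Run W (.loop b p) s' t' s'' →
      Run W (.loop b p) s (b.cost + t + t') s''

/-- `adj` gives adjacency lists of `G`, each in an arbitrary order and without repetitions. -/
def IsAdjLists {n : ℕ} (G : SimpleGraph (Fin n)) (adj : Fin n → List (Fin n)) : Prop :=
  ∀ v, (adj v).Nodup ∧ ∀ w, w ∈ adj v ↔ G.Adj v w

/-- The initial state for a graph with vertices `0, …, n - 1`, given by adjacency lists, and a
vertex `u`. Register `0` holds `n` and register `1` holds `u`. Array `1` holds the adjacency lists
of `0, …, n - 1` one after the other, and array `0` their boundaries: the list of `v` occupies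
the cells of array `1` from `arr 0 v` to `arr 0 (v + 1) - 1`. All the other memory is zero. -/
def inputState {n : ℕ} (adj : Fin n → List (Fin n)) (u : Fin n) : State where
  reg x := if x = 0 then n else if x = 1 then u else 0
  arr a i :=
    if a = 0 then (if i ≤ n then (((List.ofFn adj).take i).map List.length).sum else 0)
    else if a = 1 then ((List.ofFn adj).flatten.map Fin.val).getD i 0
    else 0

end SearchDiam

/-! Let e = e(u). Then ℓ(u) is e or e + 1. If e ≤ 1, primality forces all distances to be at most 1
(`dist_le_one_of_universal`) and ℓ(u) = e. If e ≥ 2, then ℓ(u) = e + 1 exactly when d(x,z) = e + 1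
for some neighbour x of u and some z, and such a z satisfies d(u,z) = e. A breadth-first search from
each such z would be too slow; searches are made from extremities instead, at most one from each.

Say that z covers w if w lies in the closed neighbourhood of the component of u in G - N(z)
(`Covers`). Two facts carry the proof.

(1) If d(u,z) ≥ 2, some extremity w is not covered by z. Start with K, the component of u in G -
N(z), and add vertices of N[K] to K as long as N[K] ≠ V. In the end every vertex of N[K] \ K is
adjacent to everything outside N[K], so V \ N[K] is a module. By primality it is a single vertex w,
and V \ N[w] = K is connected (`isExtremity_of_dominated`).

(2) Let d(w,x) ≤ e for all neighbours x of u, and let p, p' be the last vertices before w on a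
shortest path from x. If v is adjacent to p or p' for every x, then d(x,v) ≤ e for every x and v can
be discarded (`Last.dist_le_of_adj`). If this fails for some x and d(u,v) = e, the whole path from x
to p avoids N(v), because its earlier vertices are too close to u; so v covers w (`Last.covers`).

A round takes an undiscarded z at distance e, finds w by (1) and searches from w. Either some d(w,x)
> e and the answer is e + 1, or (2) discards z and leaves only vertices that cover w. Since every
undiscarded vertex at distance e covers all extremities used before, the w of a round is always new,
and there are at most q rounds. A round takes linear time because the adjacency test of (2) is done
by counting ancestors (`sum_count_add_eq_countP`).

For the second bound, a prime graph with at least two vertices is isomorphic to its quotient, so its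
extremities contain no independent set of more than α vertices. A Turán-type estimate
(`card_sq_le_of_indep`) gives q ≤ 4α√m. -/

namespace SearchDiam

/-! ### A Hoare logic with time bounds -/

/-- With word bound `W`, the program `p` started in `s` halts after at most `T` units of time in a
state that satisfies `Q`. -/
def Ends (W : ℕ) (p : Prog) (s : State) (T : ℕ) (Q : State → Prop) : Prop :=
  ∃ t s', Run W p s t s' ∧ t ≤ T ∧ Q s'

/-- The program contains an assignment to the register `x`. -/
def Prog.writesReg : Prog → ℕ → Bool
  | .nop, _ => false
  | .setReg y _, x => y == x
  | .setArr _ _ _, _ => false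
  | .seq p q, x => p.writesReg x || q.writesReg x
  | .cond _ p q, x => p.writesReg x || q.writesReg x
  | .loop _ p, x => p.writesReg x

/-- The program contains an assignment to a cell of the array `a`. -/
def Prog.writesArr : Prog → ℕ → Bool
  | .nop, _ => false
  | .setReg _ _, _ => false
  | .setArr b _ _, a => b == a
  | .seq p q, a => p.writesArr a || q.writesArr a
  | .cond _ p q, a => p.writesArr a || q.writesArr a
  | .loop _ p, a => p.writesArr a

/-- The states `s` and `s'` agree on all registers and arrays that `p` does not write. -/
def Frame (p : Prog) (s s' : State) : Prop :=
  (∀ x, p.writesReg x = false → s'.reg x = s.reg x) ∧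
    ∀ a, p.writesArr a = false → s'.arr a = s.arr a

theorem Frame.refl (p : Prog) (s : State) : Frame p s s := ⟨fun _ _ => rfl, fun _ _ => rfl⟩

theorem Frame.trans {p : Prog} {s s' s'' : State} (h : Frame p s s') (h' : Frame p s' s'') :
    Frame p s s'' :=
  ⟨fun x hx => (h'.1 x hx).trans (h.1 x hx), fun a ha => (h'.2 a ha).trans (h.2 a ha)⟩

theorem Frame.mono {p q : Prog} {s s' : State} (h : Frame p s s')
    (hr : ∀ x, q.writesReg x = false → p.writesReg x = false)
    (ha : ∀ a, q.writesArr a = false → p.writesArr a = false) : Frame q s s' :=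
  ⟨fun x hx => h.1 x (hr x hx), fun a h' => h.2 a (ha a h')⟩

/-- Whether a program writes a register or an array is a Boolean computation on syntax, so for
concrete programs the side conditions below close by `rfl`, and invariants need to mention only what
changes. -/
theorem Run.frame {W : ℕ} {p : Prog} {s s' : State} {t : ℕ} (h : Run W p s t s') :
    Frame p s s' := by
  induction h with
  | nop s => exact Frame.refl _ _
  | setReg s x e _ =>
    refine ⟨fun y hy => ?_, fun _ _ => rfl⟩
    have : x ≠ y := by simpa [Prog.writesReg] using hy
    simp [State.setReg, Function.update_of_ne this.symm]
  | setArr s a i e _ _ =>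
    refine ⟨fun _ _ => rfl, fun b hb => ?_⟩
    have : a ≠ b := by simpa [Prog.writesArr] using hb
    simp [State.setArr, Function.update_of_ne this.symm]
  | seq _ _ ih ih' =>
    exact (ih.mono (by simp +contextual [Prog.writesReg]) (by simp +contextual
      [Prog.writesArr])).trans (ih'.mono (by simp +contextual [Prog.writesReg])
      (by simp +contextual [Prog.writesArr]))
  | cond_true _ _ _ ih =>
    exact ih.mono (by simp +contextual [Prog.writesReg]) (by simp +contextual [Prog.writesArr])
  | cond_false _ _ _ ih =>
    exact ih.mono (by simp +contextual [Prog.writesReg]) (by simp +contextual [Prog.writesArr])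
  | loop_done _ _ => exact Frame.refl _ _
  | loop_step _ _ _ _ ih ih' => exact (ih.mono (fun _ h => h) (fun _ h => h)).trans ih'

theorem Ends.frame {W : ℕ} {p : Prog} {s : State} {T : ℕ} {Q : State → Prop}
    (h : Ends W p s T Q) : Ends W p s T fun s' => Q s' ∧ Frame p s s' := by
  obtain ⟨t, s', hr, ht, hQ⟩ := h
  exact ⟨t, s', hr, ht, hQ, hr.frame⟩

theorem Ends.mono {W : ℕ} {p : Prog} {s : State} {T T' : ℕ} {Q Q' : State → Prop}
    (h : Ends W p s T Q) (hT : T ≤ T') (hQ : ∀ s', Q s' → Q' s') : Ends W p s T' Q' := by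
  obtain ⟨t, s', hr, ht, hs⟩ := h
  exact ⟨t, s', hr, ht.trans hT, hQ _ hs⟩

theorem Ends.seq {W : ℕ} {p q : Prog} {s : State} {T T' : ℕ} {R Q : State → Prop}
    (hp : Ends W p s T R) (hq : ∀ s', R s' → Frame p s s' → Ends W q s' T' Q) :
    Ends W (.seq p q) s (T + T') Q := by
  obtain ⟨t, s', hr, ht, hR⟩ := hp
  obtain ⟨t', s'', hr', ht', hQ⟩ := hq s' hR hr.frame
  exact ⟨_, _, hr.seq hr', by omega, hQ⟩

theorem Ends.cond {W : ℕ} {b : Test} {p q : Prog} {s : State} {T : ℕ} {Q : State → Prop}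
    (hb : b.Fits W s) (hp : b.Holds s → Ends W p s T Q) (hq : ¬ b.Holds s → Ends W q s T Q) :
    Ends W (.cond b p q) s (b.cost + T) Q := by
  by_cases h : b.Holds s
  · obtain ⟨t, s', hr, ht, hQ⟩ := hp h
    exact ⟨_, _, .cond_true hb h hr, by omega, hQ⟩
  · obtain ⟨t, s', hr, ht, hQ⟩ := hq h
    exact ⟨_, _, .cond_false hb h hr, by omega, hQ⟩

/-- The weakest precondition of a program without loops. -/
def Prog.wp (W : ℕ) : Prog → State → (State → Prop) → Prop
  | .nop, s, Q => Q s
  | .setReg x e, s, Q => e.Fits W s ∧ Q (s.setReg x (e.val s))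
  | .setArr a i e, s, Q => i.Fits W s ∧ e.Fits W s ∧ Q (s.setArr a (i.val s) (e.val s))
  | .seq p q, s, Q => p.wp W s fun s' => q.wp W s' Q
  | .cond b p q, s, Q => b.Fits W s ∧ (b.Holds s → p.wp W s Q) ∧ (¬ b.Holds s → q.wp W s Q)
  | .loop _ _, _, _ => False

/-- An upper bound for the running time of a program without loops. -/
def Prog.maxCost : Prog → ℕ
  | .nop => 1
  | .setReg _ e => e.cost + 1
  | .setArr _ i e => i.cost + e.cost + 1
  | .seq p q => p.maxCost + q.maxCost
  | .cond b p q => b.cost + max p.maxCost q.maxCost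
  | .loop _ _ => 0

theorem Ends.of_wp {W : ℕ} {p : Prog} {s : State} {T : ℕ} {Q : State → Prop}
    (h : p.wp W s Q) (hT : p.maxCost ≤ T) : Ends W p s T Q := by
  refine Ends.mono ?_ hT fun _ h => h
  clear hT
  induction p generalizing s Q with
  | nop => exact ⟨_, _, .nop s, le_rfl, h⟩
  | setReg x e => exact ⟨_, _, .setReg s x e h.1, le_rfl, h.2⟩
  | setArr a i e => exact ⟨_, _, .setArr s a i e h.1 h.2.1, le_rfl, h.2.2⟩
  | seq p q ihp ihq => exact (ihp h).seq fun s' hs' _ => ihq hs'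
  | cond b p q ihp ihq =>
    exact Ends.cond h.1 (fun hb => (ihp (h.2.1 hb)).mono (le_max_left _ _) fun _ h => h)
      fun hb => (ihq (h.2.2 hb)).mono (le_max_right _ _) fun _ h => h
  -- The precondition of a loop is `False`, so the value 0 of `maxCost` on loops is never used.
  | loop b p => exact h.elim

theorem Test.one_le_cost (b : Test) : 1 ≤ b.cost := by
  cases b <;> simp [Test.cost]

/-- The rule for loops: the potential `Φ` pays for the remaining iterations. -/
theorem Ends.loop {γ : Type*} {W : ℕ} {b : Test} {p : Prog} {s₀ : State}
    (I : γ → State → Prop) (Φ : γ → ℕ) (g₀ : γ)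
    (hstep : ∀ g s, Frame (.loop b p) s₀ s → I g s → b.Fits W s ∧ (b.Holds s →
      ∃ T, Ends W p s T fun s' => ∃ g', I g' s' ∧ T + b.cost + Φ g' ≤ Φ g))
    (h₀ : I g₀ s₀) :
    Ends W (.loop b p) s₀ (Φ g₀ + b.cost) fun s' => ∃ g, I g s' ∧ ¬ b.Holds s' := by
  -- A test costs at least one unit, so Φ drops strictly in each iteration; the induction is on an
  -- upper bound for Φ.
  suffices H : ∀ k g s, Φ g ≤ k → Frame (.loop b p) s₀ s → I g s →
      Ends W (.loop b p) s (Φ g + b.cost) fun s' => ∃ g, I g s' ∧ ¬ b.Holds s' from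
    H _ g₀ s₀ le_rfl (Frame.refl _ _) h₀
  intro k
  induction k with
  | zero =>
    intro g s hk hf hI
    obtain ⟨hb, hs⟩ := hstep g s hf hI
    by_cases hh : b.Holds s
    · obtain ⟨T, t, s', -, -, g', -, hg⟩ := hs hh
      have := b.one_le_cost
      omega
    · exact ⟨_, _, .loop_done hb hh, by omega, g, hI, hh⟩
  | succ k ih =>
    intro g s hk hf hI
    obtain ⟨hb, hs⟩ := hstep g s hf hI
    by_cases hh : b.Holds s
    · obtain ⟨T, t, s', hr, ht, g', hI', hg⟩ := hs hh
      have := b.one_le_cost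
      obtain ⟨t', s'', hr', ht', hQ⟩ := ih g' s' (by omega)
        (hf.trans (hr.frame.mono (fun _ h => h) fun _ h => h)) hI'
      exact ⟨_, _, .loop_step hb hh hr hr', by omega, hQ⟩
    · exact ⟨_, _, .loop_done hb hh, by omega, g, hI, hh⟩

/-! ### Loops over the vertices and over an adjacency list -/

/-- `forBelow i p` runs `p` for each value of the register `i` below the value of the
register `0`. -/
def forBelow (i : ℕ) (p : Prog) : Prog :=
  .seq (.setReg i (.lit 0)) (.loop (.lt (.reg i) (.reg 0))
    (.seq p (.setReg i (.add (.reg i) (.lit 1)))))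

theorem Ends.forBelow {W n i : ℕ} {p : Prog} {s₀ : State} (I : ℕ → State → Prop)
    (T : Fin n → ℕ) (hn : s₀.reg 0 = n) (hW : n + 2 < W) (hi : i ≠ 0)
    (hpi : p.writesReg i = false) (hp0 : p.writesReg 0 = false)
    (hI : ∀ j s k, I j s → I j (s.setReg i k))
    (hbody : ∀ (j : Fin n) s, Frame (SearchDiam.forBelow i p) s₀ s → I j s → s.reg i = j →
      Ends W p s (T j) (I (j + 1)))
    (h₀ : I 0 s₀) :
    Ends W (SearchDiam.forBelow i p) s₀ (∑ j, (T j + 7) + 5) (I n) := by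
  set q : Prog := .seq p (.setReg i (.add (.reg i) (.lit 1))) with hq
  have h0 : (SearchDiam.forBelow i p).writesReg 0 = false := by
    simp [SearchDiam.forBelow, Prog.writesReg, hi, hp0]
  have hloop : ∀ s, Frame (SearchDiam.forBelow i p) s₀ s → I 0 s → s.reg i = 0 →
      Ends W (.loop (.lt (.reg i) (.reg 0)) q) s (∑ j, (T j + 7) + 3) (I n) := by
    intro s hs hIs hsi
    have key := Ends.loop (W := W) (b := .lt (.reg i) (.reg 0)) (p := q) (s₀ := s)
      (fun (j : ℕ) s => I j s ∧ s.reg i = j ∧ j ≤ n)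
      -- The price of the iterations still to come; 7 is 3 for the test and 4 for the increment.
      (fun j => ∑ l ∈ Finset.univ.filter (fun l : Fin n => j ≤ l), (T l + 7)) 0 ?_
      ⟨hIs, hsi, by omega⟩
    · refine (key.frame).mono (by simp [Test.cost, Expr.cost]) ?_
      rintro s' ⟨⟨j, ⟨h1, h2, h3⟩, h5⟩, h4⟩
      have hr : s'.reg 0 = n := by
        rw [h4.1 0 (by simp [hq, Prog.writesReg, hi, hp0]), hs.1 0 h0, hn]
      have : j = n := by
        simp only [Test.Holds, Expr.val, h2, hr] at h5
        omega
      exact this ▸ h1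
    · rintro j s' hf ⟨h1, h2, h3⟩
      have hf' : Frame (SearchDiam.forBelow i p) s₀ s' :=
        hs.trans (hf.mono (by simp [SearchDiam.forBelow, Prog.writesReg, hq])
          (by simp [SearchDiam.forBelow, Prog.writesArr, hq]))
      have hr : s'.reg 0 = n := by rw [hf'.1 0 h0, hn]
      refine ⟨by simp [Test.Fits, Expr.Fits, h2, hr]; omega, fun hb => ?_⟩
      have hj : j < n := by simpa [Test.Holds, Expr.val, h2, hr] using hb
      refine ⟨T ⟨j, hj⟩ + 4, Ends.seq (T' := 4) (hbody ⟨j, hj⟩ s' hf' h1 h2) ?_⟩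
      intro s'' hI'' hf''
      have hri : s''.reg i = j := by rw [hf''.1 i hpi, h2]
      refine Ends.of_wp ⟨?_, ?_⟩ le_rfl
      · simp only [Expr.Fits, Expr.val, hri]
        omega
      · refine ⟨j + 1, ⟨hI _ _ _ hI'', by simp [State.setReg, Expr.val, hri], hj⟩, ?_⟩
        have : Finset.univ.filter (fun l : Fin n => j ≤ l) =
            insert ⟨j, hj⟩ (Finset.univ.filter (fun l : Fin n => j + 1 ≤ l)) := by
          ext l
          simp only [Finset.mem_filter, Finset.mem_univ, true_and, Finset.mem_insert, Fin.ext_iff]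
          omega
        rw [this, Finset.sum_insert (by simp)]
        simp only [Test.cost, Expr.cost]
        omega
  have := Ends.seq (W := W) (p := .setReg i (.lit 0)) (s := s₀) (T := 2)
    (R := fun s => I 0 s ∧ s.reg i = 0)
    (Ends.of_wp ⟨by simp [Expr.Fits]; omega, hI _ _ _ h₀, by simp [State.setReg, Expr.val]⟩
      (by simp [Prog.maxCost, Expr.cost]))
    (fun s' h hf => hloop s' (hf.mono (by
      simp +contextual [SearchDiam.forBelow, Prog.writesReg]) (by
      simp [SearchDiam.forBelow, Prog.writesArr])) h.1 h.2)
  exact this.mono (by omega) fun _ h => h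

/-- `forNbr y i v p` runs `p` for each value of the register `v` on the adjacency list of the
vertex in the register `y`. -/
def forNbr (y i v : ℕ) (p : Prog) : Prog :=
  .seq (.setReg i (.read 0 (.reg y))) (.loop (.lt (.reg i) (.read 0 (.add (.reg y) (.lit 1))))
    (.seq (.setReg v (.read 1 (.reg i))) (.seq p (.setReg i (.add (.reg i) (.lit 1))))))

/-- The number of entries of the adjacency lists of the first `i` vertices. -/
def offset {n : ℕ} (adj : Fin n → List (Fin n)) (i : ℕ) : ℕ :=
  (((List.ofFn adj).take i).map List.length).sum

/-- The state holds the input, and the word bound is large enough for all values used below. -/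
structure Holds {n : ℕ} (W : ℕ) (adj : Fin n → List (Fin n)) (u : Fin n) (s : State) : Prop where
  reg_zero : s.reg 0 = n
  reg_one : s.reg 1 = u
  arr_zero : ∀ i ≤ n, s.arr 0 i = offset adj i
  arr_one : ∀ v (j : ℕ) (h : j < (adj v).length), s.arr 1 (offset adj v + j) = (adj v)[j]
  bound : 2 * n * n + 4 * n + 8 < W
  offset_le : ∀ i ≤ n, offset adj i ≤ n * n

theorem offset_succ {n : ℕ} (adj : Fin n → List (Fin n)) (v : Fin n) :
    offset adj (v + 1) = offset adj v + (adj v).length := by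
  simp [offset, List.take_add_one]

theorem Holds.of_frame {n W : ℕ} {adj : Fin n → List (Fin n)} {u : Fin n} {s s' : State}
    {p : Prog} (h : Holds W adj u s) (hf : Frame p s s')
    (hp : (p.writesReg 0 || p.writesReg 1 || p.writesArr 0 || p.writesArr 1) = false) :
    Holds W adj u s' := by
  simp only [Bool.or_eq_false_iff] at hp
  obtain ⟨⟨⟨h0, h1⟩, h2⟩, h3⟩ := hp
  refine ⟨?_, ?_, ?_, ?_, h.bound, h.offset_le⟩
  · rw [hf.1 0 h0, h.reg_zero]
  · rw [hf.1 1 h1, h.reg_one]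
  · rw [hf.2 0 h2]
    exact h.arr_zero
  · rw [hf.2 1 h3]
    exact h.arr_one

theorem getD_flatten_add {α : Type*} (L : List (List α)) (d : α) (v : ℕ) (hv : v < L.length) (j : ℕ)
    (hj : j < L[v].length) :
    L.flatten.getD (((L.take v).map List.length).sum + j) d = L[v][j] := by
  induction L generalizing v with
  | nil => simp at hv
  | cons l L ih =>
    cases v with
    | zero =>
      simp only [List.getElem_cons_zero] at hj
      simp [List.getD_eq_getElem?_getD, List.getElem?_append_left hj, hj]
    | succ v =>
      have := ih v (by simpa using hv) (by simpa using hj)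
      simp only [List.getD_eq_getElem?_getD, List.getElem_cons_succ] at this ⊢
      rw [← this, List.flatten_cons, List.take_succ_cons, List.map_cons, List.sum_cons,
        List.getElem?_append_right (by omega)]
      congr 2
      omega

theorem holds_inputState {n W : ℕ} {G : SimpleGraph (Fin n)} {adj : Fin n → List (Fin n)}
    (hadj : IsAdjLists G adj) (u : Fin n) (hW : 2 * n * n + 4 * n + 8 < W) :
    Holds W adj u (inputState adj u) := by
  refine ⟨by simp [inputState], by simp [inputState], ?_, ?_, hW, ?_⟩
  · intro i hi
    simp [inputState, hi, offset]
  · intro v j h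
    have := getD_flatten_add ((List.ofFn adj).map (List.map Fin.val)) 0 v (by simp) j
      (by simpa using h)
    simp only [inputState, offset]
    simp only [List.getElem_map, List.getElem_ofFn, List.map_take, List.map_map] at this
    simp only [List.map_take, List.map_flatten]
    convert this using 3
    simp [Function.comp_def]
  · intro i hi
    induction i with
    | zero => simp [offset]
    | succ i ih =>
      have h1 := offset_succ adj ⟨i, hi⟩
      have h2 := ih (by omega)
      have h3 : ∀ k ≤ n, offset adj k ≤ k * n := by
        intro k hk
        induction k with
        | zero => simp [offset]
        | succ k ihk =>
          have h1 := offset_succ adj ⟨k, hk⟩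
          have h2 := ihk (by omega)
          have h3 := (hadj ⟨k, hk⟩).1.length_le_card
          simp only [Fintype.card_fin] at h3
          simp only at h1
          nlinarith
      exact (h3 _ hi).trans (Nat.mul_le_mul_right _ hi)

/-- Indexing the invariant by the treated prefix of the list makes the time proportional to the
degree. The overhead 13 consists of 6 for the test, 3 for loading the neighbour and 4 for the
increment. -/
theorem Ends.forNbr {W n y i v : ℕ} {adj : Fin n → List (Fin n)} {u : Fin n} {p : Prog}
    {s₀ : State} (hs₀ : Holds W adj u s₀) (I : List (Fin n) → State → Prop) (T : ℕ) (Y : Fin n)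
    (hy : s₀.reg y = Y)
    (hp : (p.writesReg y || p.writesReg i || p.writesReg 0 || p.writesReg 1 || p.writesArr 0 ||
      p.writesArr 1 || i == y || v == y || v == i || i == 0 || i == 1 || v == 0 || v == 1) = false)
    (hI : ∀ l s k, I l s → I l (s.setReg i k) ∧ I l (s.setReg v k))
    (hbody : ∀ (pre : List (Fin n)) (x : Fin n) (post : List (Fin n)) (s : State),
      adj Y = pre ++ x :: post → Frame (SearchDiam.forNbr y i v p) s₀ s →
      Holds W adj u s → s.reg y = Y → s.reg v = x → I pre s → Ends W p s T (I (pre ++ [x])))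
    (h₀ : I [] s₀) :
    Ends W (SearchDiam.forNbr y i v p) s₀ ((T + 13) * (adj Y).length + 9) (I (adj Y)) := by
  simp only [Bool.or_eq_false_iff, beq_eq_false_iff_ne] at hp
  obtain ⟨⟨⟨⟨⟨⟨⟨⟨⟨⟨⟨⟨hpy, hpi⟩, hp0⟩, hp1⟩, hpa0⟩, hpa1⟩, hiy⟩, hvy⟩, hvi⟩, hi0⟩, hi1⟩, hv0⟩, hv1⟩ := hp
  set q : Prog := .seq (.setReg v (.read 1 (.reg i))) (.seq p (.setReg i (.add (.reg i) (.lit 1))))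
    with hq
  have hwy : (SearchDiam.forNbr y i v p).writesReg y = false := by
    simp [SearchDiam.forNbr, Prog.writesReg, *]
  have hw : ((SearchDiam.forNbr y i v p).writesReg 0 || (SearchDiam.forNbr y i v p).writesReg 1 ||
      (SearchDiam.forNbr y i v p).writesArr 0 || (SearchDiam.forNbr y i v p).writesArr 1)
      = false := by
    simp [SearchDiam.forNbr, Prog.writesReg, Prog.writesArr, *]
  have hle := hs₀.offset_le (Y + 1) Y.2
  have hbd := hs₀.bound
  have hY := Y.2
  have hnn : 2 * n * n = n * n + n * n := by ring
  rw [offset_succ] at hle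
  have hloop : ∀ s, Frame (SearchDiam.forNbr y i v p) s₀ s → I [] s → s.reg i = offset adj Y →
      Ends W (.loop (.lt (.reg i) (.read 0 (.add (.reg y) (.lit 1)))) q) s
        ((T + 13) * (adj Y).length + 6) (I (adj Y)) := by
    intro s hs hIs hsi
    have key := Ends.loop (W := W) (b := .lt (.reg i) (.read 0 (.add (.reg y) (.lit 1)))) (p := q)
      (s₀ := s)
      (fun (l : List (Fin n)) s => I l s ∧ s.reg i = offset adj Y + l.length ∧
        ∃ post, adj Y = l ++ post)
      (fun l => (T + 13) * ((adj Y).length - l.length)) [] ?_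
      ⟨hIs, by simpa using hsi, _, rfl⟩
    · refine (key.frame).mono (by simp [Test.cost, Expr.cost]) ?_
      rintro s' ⟨⟨l, ⟨h1, h2, post, h3⟩, h5⟩, h4⟩
      have hf' : Frame (SearchDiam.forNbr y i v p) s₀ s' :=
        hs.trans (h4.mono (by simp +contextual [SearchDiam.forNbr, Prog.writesReg, hq])
          (by simp [SearchDiam.forNbr, Prog.writesArr, hq]))
      have hH := hs₀.of_frame hf' hw
      have hry : s'.reg y = Y := by rw [hf'.1 y hwy, hy]
      simp only [Test.Holds, Expr.val, h2, hry, hH.arr_zero (Y + 1) Y.2, offset_succ] at h5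
      have : post = [] := by
        have := congrArg List.length h3
        simp only [List.length_append] at this
        exact List.eq_nil_of_length_eq_zero (by omega)
      rw [this, List.append_nil] at h3
      exact h3 ▸ h1
    · rintro l s' hf ⟨h1, h2, post, h3⟩
      have hf' : Frame (SearchDiam.forNbr y i v p) s₀ s' :=
        hs.trans (hf.mono (by simp +contextual [SearchDiam.forNbr, Prog.writesReg, hq])
          (by simp [SearchDiam.forNbr, Prog.writesArr, hq]))
      have hH := hs₀.of_frame hf' hw
      have hry : s'.reg y = Y := by rw [hf'.1 y hwy, hy]
      have hl := congrArg List.length h3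
      simp only [List.length_append] at hl
      refine ⟨?_, fun hb => ?_⟩
      · simp only [Test.Fits, Expr.Fits, Expr.val, h2, hry, hH.arr_zero (Y + 1) Y.2, offset_succ]
        omega
      · simp only [Test.Holds, Expr.val, h2, hry, hH.arr_zero (Y + 1) Y.2, offset_succ] at hb
        obtain ⟨x, post, rfl⟩ : ∃ x post', post = x :: post' := by
          cases post with
          | nil => simp at hl; omega
          | cons x post => exact ⟨_, _, rfl⟩
        have hx : s'.arr 1 (offset adj Y + l.length) = x := by
          rw [hH.arr_one Y l.length (by omega)]
          simp [h3]
        refine ⟨3 + (T + 4), Ends.seq (T := 3) (R := fun s'' => I l s'' ∧ s''.reg v = x) ?_ ?_⟩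
        · refine Ends.of_wp ⟨?_, (hI _ _ _ h1).2, ?_⟩ le_rfl
          · simp only [Expr.Fits, Expr.val, h2, hx]
            omega
          · simp [State.setReg, Expr.val, h2, hx]
        · rintro s'' ⟨h1', hv'⟩ hf''
          have hf3 : Frame (SearchDiam.forNbr y i v p) s₀ s'' :=
            hf'.trans (hf''.mono (by simp +contextual [SearchDiam.forNbr, Prog.writesReg])
              (by simp [SearchDiam.forNbr, Prog.writesArr]))
          refine Ends.seq (hbody l x post s'' h3 hf3 (hs₀.of_frame hf3 hw)
            (by rw [hf3.1 y hwy, hy]) hv' h1') ?_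
          intro s3 hI3 hf4
          have hri : s3.reg i = offset adj Y + l.length := by
            rw [hf4.1 i hpi, hf''.1 i (by simp [Prog.writesReg, hvi]), h2]
          refine Ends.of_wp ⟨?_, ?_⟩ le_rfl
          · simp only [Expr.Fits, Expr.val, hri]
            omega
          · refine ⟨l ++ [x], ⟨(hI _ _ _ hI3).1, ?_, post, by simp [h3]⟩, ?_⟩
            · simp only [State.setReg, Expr.val, hri, Function.update_self, List.length_append,
                List.length_singleton]
              omega
            · simp only [Test.cost, Expr.cost, List.length_append, List.length_singleton]
              have : (adj Y).length - l.length = ((adj Y).length - (l.length + 1)) + 1 := by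
                omega
              rw [this, Nat.mul_add]
              omega
  have := Ends.seq (W := W) (p := .setReg i (.read 0 (.reg y))) (s := s₀) (T := 3)
    (R := fun s => I [] s ∧ s.reg i = offset adj Y)
    (Ends.of_wp ⟨by
      simp only [Expr.Fits, Expr.val, hy, hs₀.arr_zero Y Y.2.le]; omega, (hI _ _ _ h₀).1, by
      simp [State.setReg, Expr.val, hy, hs₀.arr_zero Y Y.2.le]⟩
      (by simp [Prog.maxCost, Expr.cost]))
    (fun s' h hf => hloop s' (hf.mono (by
      simp +contextual [SearchDiam.forNbr, Prog.writesReg]) (by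
      simp [SearchDiam.forNbr, Prog.writesArr])) h.1 h.2)
  exact this.mono (by omega) fun _ h => h

/-! ### Graphs -/

section Graphs

variable {V : Type*} {G : SimpleGraph V}

/-- There is a path from `u` to `v` all of whose vertices, except possibly `u`, are in `A`. -/
def Link (G : SimpleGraph V) (A : Set V) : V → V → Prop :=
  Relation.ReflTransGen fun a b => G.Adj a b ∧ b ∈ A

theorem Link.mono {A B : Set V} (h : A ⊆ B) {u v : V} (huv : Link G A u v) : Link G B u v :=
  Relation.ReflTransGen.mono (fun _ _ h' => ⟨h'.1, h h'.2⟩) _ _ huv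

theorem preconnected_induce_of_link {A : Set V} {u : V} (hu : u ∈ A)
    (h : ∀ v ∈ A, Link G A u v) : (G.induce A).Preconnected := by
  have key : ∀ v, Link G A u v → ∃ hv : v ∈ A, (G.induce A).Reachable ⟨u, hu⟩ ⟨v, hv⟩ := by
    intro v hv
    induction hv with
    | refl => exact ⟨hu, .refl _⟩
    | tail _ hbc ih =>
      obtain ⟨hb, hr⟩ := ih
      exact ⟨hbc.2, hr.trans (SimpleGraph.Adj.reachable (by simpa using hbc.1))⟩
  rintro ⟨a, ha⟩ ⟨b, hb⟩
  obtain ⟨_, h1⟩ := key a (h a ha)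
  obtain ⟨_, h2⟩ := key b (h b hb)
  exact h1.symm.trans h2

/-- If `K` is a connected set that cannot be enlarged by a neighbour without dominating the graph,
and `Q = N[K]` is not the whole vertex set of the prime graph, then the complement of `Q` consists
of one extremity. -/
theorem isExtremity_of_dominated (hG : IsPrime G) {u w : V} {K Q : Set V} (hu : u ∈ K)
    (hKQ : K ⊆ Q) (hnbr : ∀ y ∈ K, ∀ v, G.Adj y v → v ∈ Q) (hlink : ∀ v ∈ K, Link G K u v)
    (hmax : ∀ y ∈ Q, y ∈ K ∨ ∀ v, v ∉ Q → G.Adj y v) (hw : w ∉ Q) : IsExtremity G w := by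
  -- A vertex of Q has no neighbour outside Q if it is in K, and is adjacent to everything outside Q
  -- otherwise.
  have hmod : IsModule G Qᶜ := by
    have : ∀ x ∈ Qᶜ, ∀ y ∈ Qᶜ, G.neighborSet x \ Qᶜ ⊆ G.neighborSet y \ Qᶜ := by
      rintro x hx y hy z ⟨hz, hzQ⟩
      have hzQ' : z ∈ Q := not_not.mp hzQ
      refine ⟨?_, hzQ⟩
      rcases hmax z hzQ' with h | h
      · exact absurd (hnbr z h x ((G.mem_neighborSet x z).mp hz).symm) hx
      · exact (h y hy).symm
    exact fun x hx y hy => (this x hx y hy).antisymm (this y hy x hx)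
  have hsing : Qᶜ = {w} := by
    rcases hG _ hmod with h | h | ⟨v, h⟩
    · exact absurd (h ▸ hw : w ∈ (∅ : Set V)) (Set.notMem_empty _)
    · exact absurd (hKQ hu) (h ▸ Set.mem_univ u : u ∈ Qᶜ)
    · have : w ∈ Qᶜ := hw
      rw [h, Set.mem_singleton_iff] at this
      rw [h, this]
  -- Vertices of K have all their neighbours in Q and miss w; vertices of Q \ K see w; nothing else
  -- exists besides w.
  have hK : (closedNbhd G w)ᶜ = K := by
    ext v
    simp only [closedNbhd, Set.mem_compl_iff, Set.mem_insert_iff, SimpleGraph.mem_neighborSet,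
      not_or]
    constructor
    · rintro ⟨h1, h2⟩
      have hv : v ∈ Q := by
        by_contra hv
        exact h1 (by simpa [hsing] using (show v ∈ Qᶜ from hv))
      exact (hmax v hv).resolve_right fun h => h2 (h w hw).symm
    · intro hv
      exact ⟨fun h => hw (h ▸ hKQ hv), fun h => hw (hnbr v hv w h.symm)⟩
  unfold IsExtremity
  rw [hK]
  exact preconnected_induce_of_link hu hlink

/-- Needed for q ≥ 1, so that the linear cost outside the rounds is absorbed by qm. The set K is a
maximal connected set containing u that does not dominate the graph. -/
theorem exists_isExtremity [Finite V] (hG : IsPrime G) (u : V) : ∃ w, IsExtremity G w := by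
  classical
  let P : Set V → Prop := fun K =>
    u ∈ K ∧ (∀ v ∈ K, Link G K u v) ∧ ∃ w, ∀ y ∈ K, y ≠ w ∧ ¬ G.Adj y w
  by_cases h0 : ∃ w, u ≠ w ∧ ¬ G.Adj u w
  · have hP : P {u} := by
      refine ⟨rfl, ?_, ?_⟩
      · rintro v rfl
        exact .refl
      · obtain ⟨w, hw⟩ := h0
        exact ⟨w, by rintro y rfl; exact hw⟩
    obtain ⟨K, -, hK⟩ := (Set.toFinite {K | P K}).exists_le_maximal hP
    obtain ⟨hu, hl, w, hw⟩ := hK.1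
    refine ⟨w, isExtremity_of_dominated hG (Q := {v | v ∈ K ∨ ∃ y ∈ K, G.Adj y v}) hu
      (fun v hv => Or.inl hv) (fun y hy v hv => Or.inr ⟨y, hy, hv⟩) hl ?_ ?_⟩
    · rintro y (hy | ⟨x, hx, hxy⟩)
      · exact Or.inl hy
      · by_contra hcon
        push Not at hcon
        obtain ⟨hyK, v, hv, hyv⟩ := hcon
        simp only [Set.mem_ofPred_eq, not_or, not_exists, not_and] at hv
        refine hyK (hK.2 (y := insert y K) ⟨Or.inr hu, ?_, v, ?_⟩ (Set.subset_insert _ _)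
          (Set.mem_insert _ _))
        · rintro b (rfl | hb)
          · exact ((hl x hx).mono (Set.subset_insert _ _)).tail ⟨hxy, Set.mem_insert _ _⟩
          · exact (hl b hb).mono (Set.subset_insert _ _)
        · rintro b (rfl | hb)
          · refine ⟨?_, hyv⟩
            rintro rfl
            exact hv.2 x hx hxy
          · exact ⟨fun h => hv.1 (h ▸ hb), hv.2 b hb⟩
    · rintro (h | ⟨y, hy, h⟩)
      · exact (hw w h).1 rfl
      · exact (hw y hy).2 h
  -- If u is adjacent to all other vertices, deleting N[u] leaves the empty graph, which is
  -- preconnected.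
  · push Not at h0
    refine ⟨u, ?_⟩
    rintro ⟨a, ha⟩
    refine absurd ?_ ha
    simp only [closedNbhd, Set.mem_insert_iff, SimpleGraph.mem_neighborSet]
    by_cases h : u = a
    · exact Or.inl h.symm
    · exact Or.inr (h0 a h)

/-- The vertex `w` is equal or adjacent to a vertex that can be reached from `u` while avoiding
the neighbours of `z`. -/
def Covers (G : SimpleGraph V) (u z w : V) : Prop :=
  ∃ y, Link G {y | ¬ G.Adj z y} u y ∧ (y = w ∨ G.Adj y w)

/-- A completed search from u that does not expand neighbours of z finds every vertex covered by z;
hence a vertex that it misses is not covered. -/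
theorem Covers.mem {u z w : V} {Q : Set V} (h : Covers G u z w) (hu : u ∈ Q) (huz : ¬ G.Adj z u)
    (hQ : ∀ y ∈ Q, ¬ G.Adj z y → ∀ v, G.Adj y v → v ∈ Q) : w ∈ Q := by
  obtain ⟨y, hy, hyw⟩ := h
  have : y ∈ Q ∧ ¬ G.Adj z y := by
    clear hyw
    induction hy with
    | refl => exact ⟨hu, huz⟩
    | tail _ hbc ih =>
      obtain ⟨h1, h2⟩ := ih
      exact ⟨hQ _ h1 h2 _ hbc.1, hbc.2⟩
  rcases hyw with rfl | hyw
  · exact this.1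
  · exact hQ _ this.1 this.2 _ hyw

/-! ### Distances, shortest paths and eccentricities -/

theorem dist_le_succ_of_adj (hc : G.Connected) {a b c : V} (h : G.Adj b c) :
    G.dist a c ≤ G.dist a b + 1 :=
  (hc.dist_triangle (v := b)).trans_eq (by rw [SimpleGraph.dist_eq_one_iff_adj.mpr h])

theorem exists_adj_dist_eq (hc : G.Connected) {a b : V} {l : ℕ} (h : G.dist a b = l + 1) :
    ∃ c, G.Adj c b ∧ G.dist a c = l := by
  obtain ⟨p, hp⟩ := hc.exists_walk_length_eq_dist b a
  cases p with
  | nil => simp at h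
  | cons hadj q =>
    rename_i c
    refine ⟨c, hadj.symm, ?_⟩
    have h1 := dist_le_succ_of_adj hc (a := a) hadj.symm
    have h2 := SimpleGraph.dist_le q
    rw [SimpleGraph.Walk.length_cons] at hp
    rw [SimpleGraph.dist_comm] at h2 hp
    omega

/-- On a shortest path from x to y all vertices before y are at distance less than l from x, hence
in A. -/
theorem link_of_dist_le (hc : G.Connected) {A : Set V} {x : V} (l : ℕ) :
    ∀ y, G.dist x y ≤ l → (∀ c, G.dist x c < l → c ∈ A) → y ∈ A → Link G A x y := by
  induction l with
  | zero =>
    intro y hy _ _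
    rw [Nat.le_zero, hc.dist_eq_zero_iff] at hy
    exact hy ▸ .refl
  | succ l ih =>
    intro y hy hA hyA
    rcases Nat.lt_or_ge (G.dist x y) (l + 1) with h | h
    · exact ih y (by omega) (fun c hc => hA c (by omega)) hyA
    · obtain ⟨c, hcy, hxc⟩ := exists_adj_dist_eq hc (le_antisymm hy h)
      exact (ih c hxc.le (fun c hc => hA c (by omega)) (hA c (by omega))).tail ⟨hcy, hyA⟩

/-- The vertices `p` and `p'` are the last two vertices before `w` on a shortest path from `x`
to `w` (both are `x` if `x` is adjacent to `w`). -/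
structure Last (G : SimpleGraph V) (w x p p' : V) : Prop where
  adj : G.Adj w p
  dist_le : G.dist p x ≤ G.dist w x - 1
  dist_le' : G.dist p' x ≤ G.dist w x - 2
  eq_or_adj : p' = p ∨ G.Adj p p'

/-- Both p and p' are within e - 1 of x; 1 ≤ e keeps the truncated subtraction harmless. -/
theorem Last.dist_le_of_adj (hc : G.Connected) {w x p p' z : V} {e : ℕ} (h : Last G w x p p')
    (he : 1 ≤ e) (hx : G.dist w x ≤ e) (hz : G.Adj z p ∨ G.Adj z p') : G.dist x z ≤ e := by
  have h1 := h.dist_le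
  have h2 := h.dist_le'
  rw [SimpleGraph.dist_comm] at h1 h2
  rcases hz with hz | hz
  · have := dist_le_succ_of_adj hc (a := x) hz.symm
    omega
  · have := dist_le_succ_of_adj hc (a := x) hz.symm
    omega

/-- A neighbour c of z with d(x,c) ≤ d(w,x) - 3 would give d(u,z) ≤ 1 + (e - 3) + 1 < e. So only p
and p' could meet N(z), which is excluded, and u reaches a neighbour of w while avoiding N(z). -/
theorem Last.covers (hc : G.Connected) {u w x p p' z : V} {e : ℕ} (h : Last G w x p p')
    (hux : G.Adj u x) (hz : G.dist u z = e) (hx : G.dist w x ≤ e)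
    (hp : ¬ G.Adj z p) (hp' : ¬ G.Adj z p') : Covers G u z w := by
  have hball : ∀ c, G.dist x c < G.dist w x - 2 → c ∈ {y | ¬ G.Adj z y} := by
    intro c hxc hzc
    have h1 : G.dist u z ≤ G.dist u c + 1 := dist_le_succ_of_adj hc hzc.symm
    have h2 : G.dist u c ≤ G.dist u x + G.dist x c := hc.dist_triangle
    rw [SimpleGraph.dist_eq_one_iff_adj.mpr hux] at h2
    omega
  have h2 := h.dist_le'
  rw [SimpleGraph.dist_comm] at h2
  -- If d(w,x) ≤ 2, the truncated bound on d(p',x) is 0 and x is p' itself.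
  have hxA : x ∈ {y | ¬ G.Adj z y} := by
    rcases Nat.eq_zero_or_pos (G.dist w x - 2) with h0 | h0
    · rw [h0, Nat.le_zero, hc.dist_eq_zero_iff] at h2
      exact h2 ▸ hp'
    · exact hball x (by simpa using h0)
  have hl : Link G {y | ¬ G.Adj z y} u p' :=
    (Relation.ReflTransGen.single ⟨hux, hxA⟩).trans (link_of_dist_le hc _ p' h2 hball hp')
  rcases h.eq_or_adj with rfl | hpp
  · exact ⟨p', hl, Or.inr h.adj.symm⟩
  · exact ⟨p, hl.tail ⟨hpp.symm, hp⟩, Or.inr h.adj.symm⟩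

theorem eccent_le_of_dist_le (hc : G.Connected) {x : V} {k : ℕ} (h : ∀ v, G.dist x v ≤ k) :
    G.eccent x ≤ k := by
  rw [SimpleGraph.eccent_le_iff]
  intro v
  rw [← (hc x v).coe_dist_eq_edist]
  exact_mod_cast h v

theorem le_eccent_of_le_dist (hc : G.Connected) {x v : V} {k : ℕ} (h : k ≤ G.dist x v) :
    (k : ℕ∞) ≤ G.eccent x := by
  refine le_trans ?_ (SimpleGraph.edist_le_eccent (v := v))
  rw [← (hc x v).coe_dist_eq_edist]
  exact_mod_cast h

theorem ell_eq_of_mem (hc : G.Connected) {u x v : V} {k : ℕ} (hx : x ∈ closedNbhd G u)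
    (hv : k ≤ G.dist x v) (hk : ∀ y ∈ closedNbhd G u, ∀ w, G.dist y w ≤ k) :
    (k : ℕ∞) = ell G u ∧ G.eccent x = ell G u := by
  have h1 : ell G u ≤ k := iSup₂_le fun y hy => eccent_le_of_dist_le hc (hk y hy)
  have h2 : G.eccent x ≤ ell G u :=
    le_iSup₂ (f := fun y (_ : y ∈ closedNbhd G u) => G.eccent y) x hx
  have h3 := le_eccent_of_le_dist hc hv
  exact ⟨(h3.trans h2).antisymm h1, h2.antisymm (h1.trans h3)⟩

/-- If a vertex `u` of a prime graph is adjacent to all other vertices, then no two vertices have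
distance greater than `1`. -/
theorem dist_le_one_of_universal (hG : IsPrime G) (hc : G.Connected) {u : V}
    (hu : ∀ v, G.dist u v ≤ 1) (x y : V) : G.dist x y ≤ 1 := by
  have hadj : ∀ v, v ≠ u → G.Adj u v := by
    intro v hv
    rw [← SimpleGraph.dist_eq_one_iff_adj]
    have := (hc.dist_eq_zero_iff (u := u) (v := v)).not.mpr hv.symm
    have := hu v
    omega
  -- All other vertices have u as their only neighbour outside the complement of u. Primality then
  -- leaves at most one other vertex.
  have hmod : IsModule G {u}ᶜ := by
    have : ∀ x ∈ ({u} : Set V)ᶜ, G.neighborSet x \ {u}ᶜ = {u} := by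
      intro x hx
      ext v
      simp only [Set.mem_sdiff, SimpleGraph.mem_neighborSet, Set.mem_compl_iff,
        Set.mem_singleton_iff, not_not, and_iff_right_iff_imp]
      rintro rfl
      exact (hadj x hx).symm
    intro x hx y hy
    rw [this x hx, this y hy]
  rcases eq_or_ne x u with rfl | hx
  · exact hu y
  rcases eq_or_ne y u with rfl | hy
  · rw [SimpleGraph.dist_comm]
    exact hu x
  rcases hG _ hmod with h | h | ⟨v, h⟩
  · exact absurd (h ▸ hx : x ∈ (∅ : Set V)) (Set.notMem_empty _)
  · exact absurd rfl (h ▸ Set.mem_univ u : u ∈ ({u} : Set V)ᶜ)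
  · have h1 : x ∈ ({u} : Set V)ᶜ := hx
    have h2 : y ∈ ({u} : Set V)ᶜ := hy
    rw [h, Set.mem_singleton_iff] at h1 h2
    simp [h1, h2]

end Graphs

/-! ### Few pairwise nonadjacent extremities -/

section Extremities

variable {V : Type*}

theorem IsExtremity.map_iso {V' : Type*} {G : SimpleGraph V} {H : SimpleGraph V'} (f : G ≃g H)
    {v : V} (hv : IsExtremity G v) : IsExtremity H (f v) := by
  have hmem : ∀ x, f x ∈ (closedNbhd H (f v))ᶜ ↔ x ∈ (closedNbhd G v)ᶜ := by
    intro x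
    simp [closedNbhd, f.map_adj_iff]
  refine SimpleGraph.Preconnected.map
    (SimpleGraph.induceHom (s := (closedNbhd G v)ᶜ) (t := (closedNbhd H (f v))ᶜ) f.toHom
      (fun x hx => (hmem x).mpr hx)) ?_ hv
  rintro ⟨y, hy⟩
  obtain ⟨x, rfl⟩ := f.surjective y
  exact ⟨⟨x, (hmem x).mp hy⟩, rfl⟩

theorem isModule_singleton (G : SimpleGraph V) (v : V) : IsModule G {v} := by
  rintro x rfl y rfl
  rfl

/-- Singletons overlap no set, so they are strong, and in a prime graph nothing lies strictly
between them and V. Two vertices are needed for a singleton to differ from V. -/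
theorem mem_maxStrongModules_iff [Nontrivial V] {G : SimpleGraph V} (hG : IsPrime G) (M : Set V) :
    M ∈ maxStrongModules G ↔ ∃ v, M = {v} := by
  have hne : ∀ v : V, ({v} : Set V) ≠ Set.univ := fun v h => by
    obtain ⟨w, hw⟩ := exists_ne v
    exact hw (h ▸ Set.mem_univ w : w ∈ ({v} : Set V))
  have hstrong : ∀ v, IsStrongModule G {v} := by
    refine fun v => ⟨isModule_singleton G v, fun M' _ => ?_⟩
    by_cases h : v ∈ M'
    · exact Or.inl (Set.singleton_subset_iff.mpr h)
    · exact Or.inr (Or.inr (Set.disjoint_singleton_left.mpr h))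
  constructor
  · intro h
    rcases hG M h.1.1.1 with rfl | rfl | h'
    · obtain ⟨v, -⟩ := exists_pair_ne V
      exact absurd (h.2 (y := {v}) ⟨hstrong v, hne v⟩ (Set.empty_subset _) rfl)
        (Set.notMem_empty v)
    · exact absurd rfl h.1.2
    · exact h'
  · rintro ⟨v, rfl⟩
    refine ⟨⟨hstrong v, hne v⟩, fun M' hM' hv => ?_⟩
    rcases hG M' hM'.1.1 with rfl | rfl | ⟨w, rfl⟩
    · exact absurd (hv rfl) (Set.notMem_empty v)
    · exact absurd rfl hM'.2
    · have : v = w := hv rfl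
      rw [this]

/-- A prime graph with at least two vertices is isomorphic to its quotient graph. -/
theorem nonempty_iso_quotientGraph [Nontrivial V] {G : SimpleGraph V} (hG : IsPrime G) :
    Nonempty (G ≃g quotientGraph G) := by
  refine ⟨⟨Equiv.ofBijective
    (fun v => ⟨{v}, (mem_maxStrongModules_iff hG _).mpr ⟨v, rfl⟩⟩) ⟨?_, ?_⟩, ?_⟩⟩
  · intro v w h
    simpa using h
  · rintro ⟨M, hM⟩
    obtain ⟨v, rfl⟩ := (mem_maxStrongModules_iff hG _).mp hM
    exact ⟨v, rfl⟩
  · intro v w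
    change (_ ∧ ∀ x ∈ ({v} : Set V), ∀ y ∈ ({w} : Set V), G.Adj x y) ↔ _
    simp only [Set.mem_singleton_iff, forall_eq]
    refine ⟨fun h => h.2, fun h => ⟨fun h' => h.ne ?_, h⟩⟩
    simpa using h'

theorem InExt.card_le [Nontrivial V] {G : SimpleGraph V} (hG : IsPrime G) {α : ℕ}
    (h : InExt α G) {I : Finset V} (hI : ∀ v ∈ I, IsExtremity G v) (hind : G.IsIndepSet I) :
    I.card ≤ α := by
  obtain ⟨f⟩ := nonempty_iso_quotientGraph hG
  have := h.2 (f '' I) (by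
    rintro _ ⟨v, hv, rfl⟩
    exact (hI v hv).map_iso f) (by
    rintro _ ⟨v, hv, rfl⟩ _ ⟨w, hw, rfl⟩ hne hadj
    exact hind hv hw (fun h => hne (congrArg f h)) (f.map_adj_iff.mp hadj))
  rw [f.injective.encard_image, Set.encard_coe_eq_coe_finsetCard] at this
  exact_mod_cast this

/-- Turán's bound, up to a constant factor. -/
theorem card_sq_le_of_indep [Fintype V] [DecidableEq V] (G : SimpleGraph V) [DecidableRel G.Adj]
    (S : Finset V) (α : ℕ) (hS : ∀ I ⊆ S, G.IsIndepSet (I : Set V) → I.card ≤ α)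
    (hm : 0 < G.edgeFinset.card) :
    S.card * S.card ≤ 2 * (α * (4 * G.edgeFinset.card + S.card)) := by
  set m := G.edgeFinset.card
  set q := S.card with hq
  -- The vertices of S of degree at most 4m/q. As the degrees sum to 2m, at most half of S has
  -- larger degree.
  set L := S.filter fun v => G.degree v * q ≤ 4 * m with hL
  set H := S.filter fun v => ¬ G.degree v * q ≤ 4 * m with hH
  have hLH : L.card + H.card = q := Finset.card_filter_add_card_filter_not _
  have hHcard : 2 * H.card ≤ q := by
    have h1 : H.card * (4 * m) ≤ ∑ v ∈ H, G.degree v * q := by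
      rw [← smul_eq_mul]
      exact Finset.card_nsmul_le_sum _ _ _ fun v hv => by
        have := (Finset.mem_filter.mp hv).2
        omega
    have h2 : ∑ v ∈ H, G.degree v * q ≤ 2 * m * q := by
      rw [← Finset.sum_mul, ← G.sum_degrees_eq_twice_card_edges]
      exact Nat.mul_le_mul_right _ (Finset.sum_le_sum_of_subset (Finset.subset_univ _))
    have h3 : (2 * H.card) * (2 * m) ≤ q * (2 * m) := by nlinarith
    exact Nat.le_of_mul_le_mul_right h3 (by omega)
  -- A maximal independent subset I of L: its closed neighbourhoods cover L, and each has at most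
  -- 4m/q + 1 vertices.
  obtain ⟨I, -, hI⟩ := (Set.toFinite {I : Finset V | I ⊆ L ∧ G.IsIndepSet (I : Set V)}).exists_le_maximal
    (a := ∅) (by simp [SimpleGraph.IsIndepSet])
  have hcov : L ⊆ I.biUnion fun v => insert v (G.neighborFinset v) := by
    intro v hv
    by_contra hcon
    simp only [Finset.mem_biUnion, Finset.mem_insert, SimpleGraph.mem_neighborFinset, not_exists,
      not_and, not_or] at hcon
    have hvI : v ∉ I := fun h => (hcon v h).1 rfl
    refine hvI (hI.2 (y := insert v I) ⟨Finset.insert_subset hv hI.1.1, ?_⟩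
      (Finset.subset_insert _ _) (Finset.mem_insert_self _ _))
    intro a ha b hb hab hadj
    simp only [Finset.coe_insert, Set.mem_insert_iff, Finset.mem_coe] at ha hb
    rcases ha with rfl | ha <;> rcases hb with rfl | hb
    · exact hab rfl
    · exact (hcon b hb).2 hadj.symm
    · exact (hcon a ha).2 hadj
    · exact hI.1.2 ha hb hab hadj
  have h4 : L.card ≤ ∑ v ∈ I, (G.degree v + 1) :=
    (Finset.card_le_card hcov).trans (Finset.card_biUnion_le.trans
      (Finset.sum_le_sum fun v _ => (Finset.card_insert_le _ _)))
  have h5 : (∑ v ∈ I, (G.degree v + 1)) * q ≤ I.card * (4 * m + q) := by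
    rw [Finset.sum_mul, ← smul_eq_mul]
    refine Finset.sum_le_card_nsmul _ _ _ fun v hv => ?_
    have := (Finset.mem_filter.mp (hI.1.1 hv)).2
    nlinarith
  have h6 : I.card ≤ α := hS I (hI.1.1.trans (Finset.filter_subset _ _)) hI.1.2
  have h7 : L.card * q ≤ α * (4 * m + q) :=
    (Nat.mul_le_mul_right q h4).trans (h5.trans (Nat.mul_le_mul_right _ h6))
  have h8 : q ≤ 2 * L.card := by omega
  nlinarith [Nat.mul_le_mul_right q h8]

theorem InExt.numExtremities_mul_le [Finite V] {G : SimpleGraph V} (hG : IsPrime G) {α : ℕ}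
    (h : InExt α G) :
    ((numExtremities G * numEdges G : ℕ) : ℝ) ≤ 4 * ((α : ℝ) * (numEdges G : ℝ) ^ (3 / 2 : ℝ)) := by
  classical
  have := Fintype.ofFinite V
  have hm : numEdges G = G.edgeFinset.card := by
    rw [numEdges, ← SimpleGraph.coe_edgeFinset, Set.ncard_coe_finset]
  rcases Nat.eq_zero_or_pos (numEdges G) with h0 | h0
  · rw [h0]
    simp
  set S := Finset.univ.filter fun v => IsExtremity G v with hS
  have hq : numExtremities G = S.card := by
    rw [numExtremities, ← Set.ncard_coe_finset]
    simp [hS]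
  have hnt : Nontrivial V := by
    obtain ⟨e, he⟩ := Finset.card_pos.mp (hm ▸ h0)
    induction e with
    | h a b => exact ⟨a, b, (SimpleGraph.mem_edgeFinset.mp he).ne⟩
  have h1 := card_sq_le_of_indep G S α (fun I hI hind => h.card_le hG
    (fun v hv => (Finset.mem_filter.mp (hI hv)).2) hind) (hm ▸ h0)
  have h2 := h.1.card_vert_le_card_edgeSet_add_one
  have h3 : S.card ≤ Nat.card V := by
    rw [Nat.card_eq_fintype_card]
    exact Finset.card_le_univ _
  rw [← hm] at h1
  have h2' : Nat.card V ≤ numEdges G + 1 := by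
    rwa [Nat.card_coe_set_eq] at h2
  rw [hq]
  set q := S.card
  set m := numEdges G
  -- Since q ≤ n ≤ m + 1 ≤ 2m, the factor 4m + q is at most 6m. With α ≤ α² and 12 ≤ 4² this gives q
  -- ≤ 4α√m.
  have h4 : q * q ≤ 12 * (α * m) := by
    have : q ≤ 2 * m := by omega
    nlinarith [Nat.mul_le_mul_left α this]
  have h5 : (α : ℝ) ≤ α * α := by
    rcases Nat.eq_zero_or_pos α with h' | h'
    · simp [h']
    · exact_mod_cast Nat.le_mul_of_pos_left α h'
  have h6 : (q : ℝ) * q ≤ 12 * (α * m) := by exact_mod_cast h4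
  have hs : √(m : ℝ) * √(m : ℝ) = m := Real.mul_self_sqrt (Nat.cast_nonneg _)
  have h7 : (q : ℝ) ≤ 4 * (α * √m) := by
    refine le_of_sq_le_sq ?_ (by positivity)
    nlinarith [mul_le_mul_of_nonneg_right h5 (Nat.cast_nonneg (α := ℝ) m), sq_nonneg ((α : ℝ) * √m)]
  have h8 : (m : ℝ) ^ (3 / 2 : ℝ) = √m * m := by
    rw [Real.sqrt_eq_rpow, show (3 / 2 : ℝ) = 1 / 2 + 1 by norm_num,
      Real.rpow_add (by exact_mod_cast h0), Real.rpow_one]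
  rw [h8]
  push_cast
  nlinarith [mul_le_mul_of_nonneg_right h7 (Nat.cast_nonneg (α := ℝ) m)]

end Extremities

/-! ### Graph search

Registers: `0` the number of vertices, `1` the given vertex, `2` its eccentricity, `3` and `4` the
answer, `5` the vertex of the main loop, `6` and `7` head and tail of the queue, `8` and `9` the
position in an adjacency list and the neighbour found there, `10` the vertex taken from the queue,
`11` a counter, `12` an extremity, `13` a loop variable.

Arrays: `2` marks, `3` the queue, `4` distances from the root, `5` and `6` ancestors at distance `1`
and `2` from the root, `7` distances from the given vertex, `8` the vertices known to be
irrelevant, `9` stamps, `10` and `11` counters. -/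

/-- Append the vertex in register `9` to the queue, as a child of the vertex in register `10`,
unless it is marked. -/
def discover : Prog :=
  .cond (.eq (.read 2 (.reg 9)) (.lit 0))
    (.seq (.setArr 2 (.reg 9) (.lit 1)) (.seq (.setArr 3 (.reg 7) (.reg 9))
      (.seq (.setReg 7 (.add (.reg 7) (.lit 1)))
        (.seq (.setArr 4 (.reg 9) (.add (.read 4 (.reg 10)) (.lit 1)))
          (.seq (.cond (.eq (.read 4 (.reg 10)) (.lit 0)) (.setArr 5 (.reg 9) (.reg 9))
              (.setArr 5 (.reg 9) (.read 5 (.reg 10))))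
            (.cond (.lt (.read 4 (.reg 10)) (.lit 2)) (.setArr 6 (.reg 9) (.reg 9))
              (.setArr 6 (.reg 9) (.read 6 (.reg 10)))))))))
    .nop

/-- Append the unmarked neighbours of the vertex in register `10` to the queue. -/
def expand : Prog := forNbr 10 8 9 discover

/-- Count the unmarked neighbours of the vertex in register `10`. -/
def countUnmarked : Prog :=
  .seq (.setReg 11 (.lit 0)) (forNbr 10 8 9 (.cond (.eq (.read 2 (.reg 9)) (.lit 0))
    (.setReg 11 (.add (.reg 11) (.lit 1))) .nop))

/-- Run through the queue and expand the vertices that pass the test. -/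
def search (b : Test) : Prog :=
  .seq (.setReg 6 (.lit 0)) (.loop (.lt (.reg 6) (.reg 7))
    (.seq (.setReg 10 (.read 3 (.reg 6))) (.seq countUnmarked
      (.seq (.cond b expand .nop) (.setReg 6 (.add (.reg 6) (.lit 1)))))))

section

variable {n W : ℕ} {adj : Fin n → List (Fin n)} {u : Fin n} {s : State} {q : List (Fin n)}
  {d a b : ℕ → ℕ}

/-- The queue of the state is `q`, its vertices are the marked ones, and `d`, `a`, `b` are the
arrays of distances and ancestors. -/
structure Queue (n : ℕ) (s : State) (q : List (Fin n)) (d a b : ℕ → ℕ) : Prop where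
  nodup : q.Nodup
  tail : s.reg 7 = q.length
  mark : ∀ v : Fin n, s.arr 2 v = if v ∈ q then 1 else 0
  cell : ∀ i (h : i < q.length), s.arr 3 i = q[i]
  arr_four : s.arr 4 = d
  arr_five : s.arr 5 = a
  arr_six : s.arr 6 = b
  dist_le : ∀ i (h : i < q.length), d q[i] ≤ i
  le_five : ∀ i, a i ≤ n
  le_six : ∀ i, b i ≤ n

theorem Queue.length_le (h : Queue n s q d a b) : q.length ≤ n := by
  simpa using h.nodup.length_le_card

theorem Queue.of_frame {s' : State} {p : Prog} (h : Queue n s q d a b) (hf : Frame p s s')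
    (hp : (p.writesReg 7 || p.writesArr 2 || p.writesArr 3 || p.writesArr 4 || p.writesArr 5 ||
      p.writesArr 6) = false) : Queue n s' q d a b := by
  simp only [Bool.or_eq_false_iff] at hp
  obtain ⟨⟨⟨⟨⟨h7, h2⟩, h3⟩, h4⟩, h5⟩, h6⟩ := hp
  exact ⟨h.nodup, by rw [hf.1 7 h7, h.tail], by rw [hf.2 2 h2]; exact h.mark,
    by rw [hf.2 3 h3]; exact h.cell, by rw [hf.2 4 h4, h.arr_four], by rw [hf.2 5 h5, h.arr_five],
    by rw [hf.2 6 h6, h.arr_six], h.dist_le, h.le_five, h.le_six⟩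

/-- The elements of `l` that are not in `q`. -/
def fresh (q l : List (Fin n)) : List (Fin n) := l.filter fun v => v ∉ q

/-- The array `d`, changed to `f` at the elements of `l` that are not in `q`. -/
def override (q l : List (Fin n)) (d f : ℕ → ℕ) : ℕ → ℕ :=
  fun i => if ∃ v ∈ l, v ∉ q ∧ (v : ℕ) = i then f i else d i

theorem mem_fresh {l : List (Fin n)} {v : Fin n} : v ∈ fresh q l ↔ v ∈ l ∧ v ∉ q := by
  simp [fresh]

theorem override_of_mem {l : List (Fin n)} {f : ℕ → ℕ} {v : Fin n} (hv : v ∈ q) :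
    override q l d f v = d v := by
  refine if_neg ?_
  rintro ⟨w, -, hw, h⟩
  exact hw (Fin.ext h ▸ hv)

theorem override_of_mem_fresh {l : List (Fin n)} {f : ℕ → ℕ} {v : Fin n} (hv : v ∈ fresh q l) :
    override q l d f v = f v :=
  if_pos ⟨v, (mem_fresh.mp hv).1, (mem_fresh.mp hv).2, rfl⟩

theorem override_append_of_mem {l : List (Fin n)} {f : ℕ → ℕ} {v : Fin n} (hv : v ∈ q) :
    override q (l ++ [v]) d f = override q l d f := by
  funext i
  have : (∃ w ∈ l ++ [v], w ∉ q ∧ (w : ℕ) = i) ↔ ∃ w ∈ l, w ∉ q ∧ (w : ℕ) = i := by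
    constructor
    · rintro ⟨w, hw, hwq, h⟩
      rcases List.mem_append.mp hw with hw | hw
      · exact ⟨w, hw, hwq, h⟩
      · exact absurd hv (List.mem_singleton.mp hw ▸ hwq)
    · rintro ⟨w, hw, hwq, h⟩
      exact ⟨w, List.mem_append_left _ hw, hwq, h⟩
  simp only [override, this]

theorem override_append_of_notMem {l : List (Fin n)} {f : ℕ → ℕ} {v : Fin n} (hv : v ∉ q) :
    override q (l ++ [v]) d f = Function.update (override q l d f) v (f v) := by
  funext i
  by_cases hi : i = v
  · subst hi
    rw [Function.update_self]
    exact if_pos ⟨v, by simp, hv, rfl⟩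
  · rw [Function.update_of_ne hi]
    have : (∃ w ∈ l ++ [v], w ∉ q ∧ (w : ℕ) = i) ↔ ∃ w ∈ l, w ∉ q ∧ (w : ℕ) = i := by
      constructor
      · rintro ⟨w, hw, hwq, h⟩
        rcases List.mem_append.mp hw with hw | hw
        · exact ⟨w, hw, hwq, h⟩
        · exact absurd (List.mem_singleton.mp hw ▸ h).symm hi
      · rintro ⟨w, hw, hwq, h⟩
        exact ⟨w, List.mem_append_left _ hw, hwq, h⟩
    simp only [override, this]

theorem Queue.discover {x y : Fin n} (hq : Queue n s q d a b) (hx : s.reg 9 = x)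
    (hy : s.reg 10 = y) (hyd : d y + 1 ≤ q.length) (hyx : x ∈ q ∨ x ≠ y) (hW : 2 * n + 4 < W) :
    Ends W SearchDiam.discover s 40 fun s' => if x ∈ q then Queue n s' q d a b else
      Queue n s' (q ++ [x]) (Function.update d x (d y + 1))
        (Function.update a x (if d y = 0 then (x : ℕ) else a y))
        (Function.update b x (if d y < 2 then (x : ℕ) else b y)) := by
  have hlen := hq.length_le
  have hxn := x.2
  have hyn := y.2
  have h5 := hq.le_five y
  have h6 := hq.le_six y
  have hm := hq.mark x
  refine Ends.of_wp ?_ (by decide)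
  by_cases hxq : x ∈ q
  · simp only [SearchDiam.discover, Prog.wp, Test.Fits, Test.Holds, Expr.Fits, Expr.val, hx, hm,
      hxq, if_true]
    refine ⟨by omega, fun h => by omega, fun _ => hq⟩
  · have hxy : (x : ℕ) ≠ y := fun h => hyx.resolve_left hxq (Fin.ext h)
    have hsucc : (q ++ [x]).length = q.length + 1 := by simp
    have hnd : (q ++ [x]).Nodup := by
      rw [List.nodup_append]
      refine ⟨hq.nodup, by simp, ?_⟩
      rintro v hv w hw rfl
      exact hxq (List.mem_singleton.mp hw ▸ hv)
    have hlen' : q.length + 1 ≤ n := by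
      have := hnd.length_le_card
      rwa [hsucc, Fintype.card_fin] at this
    simp only [SearchDiam.discover, Prog.wp, Test.Fits, Test.Holds, Expr.Fits, Expr.val, hx, hm,
      hxq, if_false, State.setReg, State.setArr, Function.update_self, hq.tail, hy, ne_eq,
      Nat.reduceEqDiff, not_false_eq_true, Function.update_of_ne, hq.arr_four,
      hq.arr_five, hq.arr_six, hxy.symm]
    have key : ∀ s' : State, s'.reg 7 = q.length + 1 → s'.arr 2 = Function.update (s.arr 2) x 1 →
        s'.arr 3 = Function.update (s.arr 3) q.length x →
        s'.arr 4 = Function.update d x (d y + 1) →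
        s'.arr 5 = Function.update a x (if d y = 0 then (x : ℕ) else a y) →
        s'.arr 6 = Function.update b x (if d y < 2 then (x : ℕ) else b y) →
        Queue n s' (q ++ [x]) (Function.update d x (d y + 1))
        (Function.update a x (if d y = 0 then (x : ℕ) else a y))
        (Function.update b x (if d y < 2 then (x : ℕ) else b y)) := by
      intro s' e7 e2 e3 e4 e5 e6
      refine ⟨hnd, by rw [e7, hsucc], ?_, ?_, e4, e5, e6, ?_, ?_, ?_⟩
      · intro v
        rw [e2]
        by_cases hv : v = x
        · simp [hv]
        · rw [Function.update_of_ne (fun h => hv (Fin.ext h)), hq.mark]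
          simp [hv]
      · intro i hi
        rw [hsucc] at hi
        rw [e3]
        by_cases h : i = q.length
        · subst h
          simp
        · rw [Function.update_of_ne h, hq.cell i (by omega), List.getElem_append_left]
      · intro i hi
        rw [hsucc] at hi
        by_cases h : i = q.length
        · subst h
          simpa using hyd
        · have hi' : i < q.length := by omega
          rw [List.getElem_append_left hi', Function.update_of_ne]
          · exact hq.dist_le i hi'
          · exact fun h => hxq (Fin.ext h ▸ List.getElem_mem hi')
      · intro i
        by_cases h : i = x
        · subst h
          rw [Function.update_self]
          split_ifs <;> omega
        · rw [Function.update_of_ne h]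
          exact hq.le_five i
      · intro i
        by_cases h : i = x
        · subst h
          rw [Function.update_self]
          split_ifs <;> omega
        · rw [Function.update_of_ne h]
          exact hq.le_six i
    refine ⟨by omega, fun _ => ⟨by omega, by omega, by omega, by omega, by omega, by omega,
      by omega, ⟨by omega, ?_, ?_⟩⟩, fun h => absurd trivial h⟩
    all_goals
      intro h0
      refine ⟨by omega, by omega, by omega, fun h2 => ⟨by omega, by omega, ?_⟩,
        fun h2 => ⟨by omega, by omega, ?_⟩⟩
      all_goals
        apply key <;> first | simp [h0, h2]; done | (exfalso; omega)

theorem Ends.expand {y : Fin n} {h : ℕ} (hs : Holds W adj u s) (hnd : (adj y).Nodup)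
    (hq : Queue n s q d a b) (hy : s.reg 10 = y) (hh : q[h]? = some y) :
    Ends W SearchDiam.expand s (53 * (adj y).length + 9) fun s' =>
      Queue n s' (q ++ fresh q (adj y)) (override q (adj y) d fun _ => d y + 1)
        (override q (adj y) a fun i => if d y = 0 then i else a y)
        (override q (adj y) b fun i => if d y < 2 then i else b y) := by
  have hbd := hs.bound
  have hnn : 0 ≤ 2 * n * n := Nat.zero_le _
  obtain ⟨hlt, hget⟩ := List.getElem?_eq_some_iff.mp hh
  have hyq : y ∈ q := hget ▸ List.getElem_mem hlt
  refine Ends.forNbr hs (fun l s' => Queue n s' (q ++ fresh q l) (override q l d fun _ => d y + 1)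
        (override q l a fun i => if d y = 0 then i else a y)
        (override q l b fun i => if d y < 2 then i else b y)) 40 y hy rfl ?_ ?_ ?_
  · intro l s' k hI
    exact ⟨hI.of_frame (Run.setReg (W := k + 1) s' 8 (.lit k) (by simp [Expr.Fits])).frame rfl,
      hI.of_frame (Run.setReg (W := k + 1) s' 9 (.lit k) (by simp [Expr.Fits])).frame rfl⟩
  · intro pre x post s' hadj hf hs' hy' hx hI
    have hxpre : x ∉ pre := by
      rw [hadj, List.nodup_append] at hnd
      exact fun hx => hnd.2.2 x hx x (by simp) rfl
    have hdy : override q pre d (fun _ => d y + 1) y = d y := override_of_mem hyq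
    have hyq' : y ∈ q ++ fresh q pre := List.mem_append_left _ hyq
    -- The list has no repetitions, so x was not appended earlier in the same expansion: marked now
    -- means marked at the start.
    have hmem : x ∈ q ++ fresh q pre ↔ x ∈ q := by
      simp [mem_fresh, hxpre]
    have hd := hq.dist_le h hlt
    rw [hget] at hd
    refine (hI.discover hx hy' ?_ ?_ (by omega)).mono le_rfl ?_
    · rw [hdy, List.length_append]
      omega
    · by_contra hcon
      push Not at hcon
      exact hcon.1 (hcon.2 ▸ hyq')
    · intro s'' hs''
      by_cases hxq : x ∈ q
      · rw [if_pos (hmem.mpr hxq)] at hs''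
        rw [override_append_of_mem hxq, override_append_of_mem hxq, override_append_of_mem hxq]
        simpa [fresh, hxq] using hs''
      · rw [if_neg (hmem.not.mpr hxq), hdy, override_of_mem hyq, override_of_mem hyq] at hs''
        rw [override_append_of_notMem hxq, override_append_of_notMem hxq,
          override_append_of_notMem hxq]
        simpa [fresh, hxq] using hs''
  · have h0 : ∀ f g : ℕ → ℕ, override q [] f g = f := fun f g => by
      funext i
      simp [override]
    rw [h0, h0, h0]
    simpa [fresh] using hq

theorem Ends.countUnmarked {y : Fin n} (hs : Holds W adj u s) (hnd : (adj y).Nodup)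
    (hq : Queue n s q d a b) (hy : s.reg 10 = y) :
    Ends W SearchDiam.countUnmarked s (26 * (adj y).length + 11) fun s' =>
      s'.reg 11 = (fresh q (adj y)).length := by
  have hbd := hs.bound
  have hnn : 0 ≤ 2 * n * n := Nat.zero_le _
  have hlen := hnd.length_le_card
  rw [Fintype.card_fin] at hlen
  have h1 : Ends W (.setReg 11 (.lit 0)) s 2 fun s' => s'.reg 11 = 0 :=
    Ends.of_wp ⟨by simp only [Expr.Fits]; omega, by simp [State.setReg, Expr.val]⟩ (by decide)
  refine (h1.seq fun s₁ h11 hf₁ => Ends.forNbr (hs.of_frame hf₁ rfl)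
    (fun l s' => s'.reg 11 = (fresh q l).length) 13 y ((hf₁.1 10 rfl).trans hy) rfl ?_ ?_ ?_).mono
    (by omega) fun _ h => h
  · intro l s' k hI
    exact ⟨by simpa [State.setReg] using hI, by simpa [State.setReg] using hI⟩
  · intro pre x post s' hadj hf hs' hy' hx hI
    have hm : s'.arr 2 x = if x ∈ q then 1 else 0 := by
      rw [hf.2 2 rfl, hf₁.2 2 rfl, hq.mark]
    have hpre : (fresh q pre).length ≤ (adj y).length := by
      refine (List.length_filter_le _ _).trans ?_
      simp [hadj]
    have hxn := x.2
    refine Ends.of_wp ?_ (by decide)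
    by_cases hxq : x ∈ q
    · have : fresh q (pre ++ [x]) = fresh q pre := by simp [fresh, hxq]
      simp only [Prog.wp, Test.Fits, Test.Holds, Expr.Fits, Expr.val, hx, hm, hxq, if_true, this]
      exact ⟨by omega, fun h => absurd h one_ne_zero, fun _ => hI⟩
    · have : fresh q (pre ++ [x]) = fresh q pre ++ [x] := by simp [fresh, hxq]
      simp only [Prog.wp, Test.Fits, Test.Holds, Expr.Fits, Expr.val, hx, hm, hxq, if_false, this,
        hI, State.setReg, Function.update_self, List.length_append, List.length_singleton]
      exact ⟨by omega, fun _ => ⟨by omega, trivial⟩, fun h => absurd trivial h⟩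
  · simpa [fresh] using h11

/-- The invariant J depends on the number of treated queue entries, the queue, and the distance and
ancestor arrays. It is instantiated by `IsBFS`, `Avoids` and `Grows`. Register 11 holds the number
of new vertices, so the test may depend on the effect of an expansion. -/
theorem Ends.search {s₀ : State} {q₀ : List (Fin n)} {d₀ a₀ b₀ : ℕ → ℕ} (t : Test)
    (J : ℕ → List (Fin n) → (ℕ → ℕ) → (ℕ → ℕ) → (ℕ → ℕ) → Prop)
    (hadj : ∀ v, (adj v).Nodup) (hs₀ : Holds W adj u s₀) (hq₀ : Queue n s₀ q₀ d₀ a₀ b₀)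
    (hJ₀ : J 0 q₀ d₀ a₀ b₀) (ht : t.cost ≤ 10)
    (hstep : ∀ (h : ℕ) (q : List (Fin n)) (d a b : ℕ → ℕ) (y : Fin n) (s : State), q[h]? = some y → q.Nodup → J h q d a b →
      Frame (search t) s₀ s → Holds W adj u s → s.reg 10 = y →
      s.reg 11 = (fresh q (adj y)).length → s.reg 7 = q.length →
      t.Fits W s ∧ (t.Holds s → J (h + 1) (q ++ fresh q (adj y))
        (override q (adj y) d fun _ => d y + 1)
        (override q (adj y) a fun i => if d y = 0 then i else a y)
        (override q (adj y) b fun i => if d y < 2 then i else b y)) ∧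
        (¬ t.Holds s → J (h + 1) q d a b)) :
    Ends W (SearchDiam.search t) s₀ (∑ v, (79 * (adj v).length + 50) + 5) fun s' =>
      ∃ q d a b, Queue n s' q d a b ∧ J q.length q d a b := by
  have hbd := hs₀.bound
  have hnn : 0 ≤ 2 * n * n := Nat.zero_le _
  have h1 : Ends W (.setReg 6 (.lit 0)) s₀ 2 fun s' => s'.reg 6 = 0 :=
    Ends.of_wp ⟨by simp only [Expr.Fits]; omega, by simp [State.setReg, Expr.val]⟩ (by decide)
  refine (h1.seq (T' := ∑ v, (79 * (adj v).length + 50) + 3) fun s₁ h6 hf₁ => ?_).mono (by omega)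
    fun _ h => h
  have hs₁ := hs₀.of_frame hf₁ rfl
  have hq₁ := hq₀.of_frame hf₁ rfl
  have key := Ends.loop (W := W) (b := .lt (.reg 6) (.reg 7))
    (p := (.seq (.setReg 10 (.read 3 (.reg 6))) (.seq SearchDiam.countUnmarked
      (.seq (.cond t SearchDiam.expand .nop) (.setReg 6 (.add (.reg 6) (.lit 1))))))) (s₀ := s₁)
    (fun (g : ℕ × List (Fin n)) s => s.reg 6 = g.1 ∧ g.1 ≤ g.2.length ∧
      ∃ d a b, Queue n s g.2 d a b ∧ J g.1 g.2 d a b)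
    -- Each vertex is taken from the queue at most once, so the vertices not yet taken pay for the
    -- rest of the search.
    (fun g => ∑ v ∈ Finset.univ.filter (fun v => v ∉ g.2.take g.1), (79 * (adj v).length + 50))
    (0, q₀) ?_ ⟨h6, Nat.zero_le _, _, _, _, hq₁, hJ₀⟩
  · refine key.mono (by simp [Test.cost, Expr.cost]) ?_
    rintro s' ⟨⟨h, q⟩, ⟨hh, hle, d, a, b, hq, hJ⟩, hb⟩
    refine ⟨q, d, a, b, hq, ?_⟩
    simp only [Test.Holds, Expr.val, hh, hq.tail] at hb
    simp only at hle
    have : h = q.length := by omega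
    exact this ▸ hJ
  · rintro ⟨h, q⟩ s hf ⟨hh, hle, d, a, b, hq, hJ⟩
    simp only at hh hle hq hJ
    have hlen := hq.length_le
    have hf₀ : Frame (SearchDiam.search t) s₀ s :=
      (hf₁.mono (by simp +contextual [SearchDiam.search, Prog.writesReg])
        (by simp [SearchDiam.search, Prog.writesArr])).trans
      (hf.mono (by simp +contextual [SearchDiam.search, Prog.writesReg])
        (by simp [SearchDiam.search, Prog.writesArr]))
    have hs := hs₀.of_frame hf₀ rfl
    refine ⟨by simp only [Test.Fits, Expr.Fits, hh, hq.tail]; omega, fun hb => ?_⟩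
    simp only [Test.Holds, Expr.val, hh, hq.tail] at hb
    have hcell := hq.cell h hb
    obtain ⟨y, hy⟩ : ∃ y, q[h] = y := ⟨_, rfl⟩
    have hy? : q[h]? = some y := List.getElem?_eq_some_iff.mpr ⟨hb, hy⟩
    rw [hy] at hcell
    have hyn := y.2
    refine ⟨3 + (26 * (adj y).length + 11 + (t.cost + (53 * (adj y).length + 9) + 4)),
      Ends.seq (R := fun s' => s'.reg 10 = y) (Ends.of_wp ⟨?_, ?_⟩ (by decide)) ?_⟩
    · simp only [Expr.Fits, Expr.val, hh, hcell]
      omega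
    · simp [State.setReg, Expr.val, hh, hcell]
    intro s₂ hy₂ hf₂
    refine Ends.seq (Ends.countUnmarked (hs.of_frame hf₂ rfl) (hadj y) (hq.of_frame hf₂ rfl) hy₂) ?_
    intro s₃ hc₃ hf₃
    have hq₃ := (hq.of_frame hf₂ rfl).of_frame hf₃ rfl
    have hs₃ := (hs.of_frame hf₂ rfl).of_frame hf₃ rfl
    have hy₃ : s₃.reg 10 = y := (hf₃.1 10 rfl).trans hy₂
    have hf₀₃ : Frame (SearchDiam.search t) s₀ s₃ :=
      (hf₀.trans (hf₂.mono (by simp +contextual [SearchDiam.search, Prog.writesReg])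
        (by simp [SearchDiam.search, Prog.writesArr]))).trans
      (hf₃.mono (by simp +contextual [SearchDiam.search, Prog.writesReg])
        (by simp +contextual [SearchDiam.search, Prog.writesArr]))
    obtain ⟨hfit, hacc, hrej⟩ := hstep h q d a b y s₃ hy? hq.nodup hJ hf₀₃ hs₃ hy₃ hc₃ hq₃.tail
    have hr6 : s₃.reg 6 = h := by rw [hf₃.1 6 rfl, hf₂.1 6 rfl, hh]
    refine Ends.seq (R := fun s' => ∃ q' d a b, Queue n s' q' d a b ∧ J (h + 1) q' d a b ∧
      h + 1 ≤ q'.length ∧ q'.take (h + 1) = q.take h ++ [y]) (Ends.cond hfit (fun hT => ?_)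
      fun hF => Ends.of_wp ?_ (by simp [Prog.maxCost])) ?_
    · refine (Ends.expand hs₃ (hadj y) hq₃ hy₃ hy?).mono le_rfl fun s' hq' =>
        ⟨_, _, _, _, hq', hacc hT, by rw [List.length_append]; omega, ?_⟩
      rw [List.take_append_of_le_length (by omega), List.take_add_one, hy?]
      rfl
    · refine ⟨_, _, _, _, hq₃, hrej hF, hb, ?_⟩
      rw [List.take_add_one, hy?]
      rfl
    · rintro s₄ ⟨q', d', a', b', hq', hJ', hle', htake⟩ hf₄
      have hr6 : s₄.reg 6 = h := by
        rw [hf₄.1 6 rfl, hr6]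
      refine Ends.of_wp ⟨?_, (h + 1, q'), ⟨?_, hle', d', a', b', ?_, hJ'⟩, ?_⟩ (by decide)
      · simp only [Expr.Fits, Expr.val, hr6]
        omega
      · simp [State.setReg, Expr.val, hr6]
      · exact hq'.of_frame (Run.setReg (W := h + 2) s₄ 6 (.lit (s₄.reg 6 + 1)) (by
          simp [Expr.Fits, hr6])).frame rfl
      · simp only [htake]
        have : Finset.univ.filter (fun v => v ∉ q.take h) =
            insert y (Finset.univ.filter (fun v => v ∉ q.take h ++ [y])) := by
          ext v
          simp only [Finset.mem_filter, Finset.mem_univ, true_and, List.mem_append,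
            List.mem_singleton, Finset.mem_insert, not_or]
          constructor
          · intro hv
            by_cases hvy : v = y
            · exact Or.inl hvy
            · exact Or.inr ⟨hv, hvy⟩
          · rintro (rfl | hv)
            · intro hmem
              obtain ⟨i, hi, hiv⟩ := List.getElem_of_mem hmem
              rw [List.length_take] at hi
              rw [List.getElem_take] at hiv
              have := (hq.nodup.getElem_inj_iff (hi := by omega) (hj := hb)).mp (hiv.trans hy.symm)
              omega
            · exact hv.1
        rw [this, Finset.sum_insert (by simp)]
        simp only [Test.cost, Expr.cost]
        omega

end

/-! ### Stamps and searches from a root -/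

section

variable {n W : ℕ} {G : SimpleGraph (Fin n)} {adj : Fin n → List (Fin n)} {u : Fin n} {s : State}
  {q : List (Fin n)} {d a b : ℕ → ℕ}

theorem mem_append_fresh {l : List (Fin n)} {v : Fin n} :
    v ∈ q ++ fresh q l ↔ v ∈ q ∨ v ∈ l := by
  rw [List.mem_append, mem_fresh]
  tauto

/-- Delete all marks and reset the counters. -/
def clear : Prog :=
  forBelow 13 (.seq (.setArr 2 (.reg 13) (.lit 0)) (.seq (.setArr 10 (.reg 13) (.lit 0))
    (.setArr 11 (.reg 13) (.lit 0))))

/-- Put the vertex in register `r` into the queue. -/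
def enqueueRoot (r : ℕ) : Prog :=
  .seq (.setArr 2 (.reg r) (.lit 1)) (.seq (.setArr 3 (.lit 0) (.reg r))
    (.seq (.setReg 7 (.lit 1)) (.setArr 4 (.reg r) (.lit 0))))

/-- A search from the vertex in register `r` that expands the vertices that pass the test. -/
def searchFrom (r : ℕ) (t : Test) : Prog := .seq clear (.seq (enqueueRoot r) (search t))

/-- Stamp the neighbours of the vertex in register `y`. -/
def stamp (y : ℕ) : Prog := forNbr y 8 9 (.setArr 9 (.reg 9) (.add (.reg y) (.lit 1)))

/-- Bounds for the contents of some arrays, and correctness of the stamps. -/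
structure Tidy (G : SimpleGraph (Fin n)) (s : State) : Prop where
  le_five : ∀ i, s.arr 5 i ≤ n
  le_six : ∀ i, s.arr 6 i ≤ n
  le_nine : ∀ i, s.arr 9 i ≤ n
  adj : ∀ x y : Fin n, s.arr 9 y = x + 1 → G.Adj x y

theorem Tidy.of_frame {s' : State} {p : Prog} (h : Tidy G s) (hf : Frame p s s')
    (hp : (p.writesArr 5 || p.writesArr 6 || p.writesArr 9) = false) : Tidy G s' := by
  simp only [Bool.or_eq_false_iff] at hp
  obtain ⟨⟨h5, h6⟩, h9⟩ := hp
  exact ⟨hf.2 5 h5 ▸ h.le_five, hf.2 6 h6 ▸ h.le_six, hf.2 9 h9 ▸ h.le_nine, hf.2 9 h9 ▸ h.adj⟩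

theorem Ends.clear (hs : Holds W adj u s) : Ends W SearchDiam.clear s (16 * n + 5) fun s' =>
    ∀ v : Fin n, s'.arr 2 v = 0 ∧ s'.arr 10 v = 0 ∧ s'.arr 11 v = 0 := by
  have hbd := hs.bound
  have hnn : 0 ≤ 2 * n * n := Nat.zero_le _
  refine (Ends.forBelow (fun j s' => ∀ v : Fin n, (v : ℕ) < j →
    s'.arr 2 v = 0 ∧ s'.arr 10 v = 0 ∧ s'.arr 11 v = 0) (fun _ => 9) hs.reg_zero (by omega)
    (by decide) rfl rfl (fun j s k h => h) ?_ (by simp)).mono (by simp; omega)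
    fun s' h v => h v v.2
  intro j s' hf hI hj
  have hjn := j.2
  refine Ends.of_wp ?_ (by decide)
  simp only [Prog.wp, Expr.Fits, Expr.val, State.setArr, hj]
  refine ⟨by omega, by omega, by omega, by omega, by omega, by omega, fun v hv => ?_⟩
  by_cases h : v = j
  · simp [h]
  · have hne : (v : ℕ) ≠ j := fun h' => h (Fin.ext h')
    simpa [Function.update_of_ne hne] using hI v (by omega)

/-- Stamps are never erased: a stale entry x + 1 still certifies adjacency to x, and it cannot be
mistaken for a stamp of z. The shift by one separates stamps from the initial zeros. -/
theorem Ends.stamp {y : ℕ} {z : Fin n} (hadj : IsAdjLists G adj) (hs : Holds W adj u s)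
    (ht : Tidy G s) (hy : s.reg y = z) (hy' : y ≠ 8) (hy'' : y ≠ 9) :
    Ends W (SearchDiam.stamp y) s (18 * (adj z).length + 9) fun s' =>
      Tidy G s' ∧ ∀ v : Fin n, s'.arr 9 v = z + 1 ↔ G.Adj z v := by
  have hbd := hs.bound
  have hnn : 0 ≤ 2 * n * n := Nat.zero_le _
  have hz := z.2
  refine (Ends.forNbr hs (fun l s' => (∀ i, s'.arr 9 i ≤ n) ∧
    (∀ x v : Fin n, s'.arr 9 v = x + 1 → G.Adj x v) ∧ ∀ v ∈ l, s'.arr 9 v = z + 1) 5 z hy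
    (by simp [Prog.writesReg, Prog.writesArr, hy'.symm, hy''.symm])
    (fun l s k h => ⟨h, h⟩) ?_ ⟨ht.le_nine, ht.adj, by simp⟩).frame.mono (by omega) ?_
  · intro pre x post s' hpre hf hs' hy hx hI
    have hxn := x.2
    refine Ends.of_wp ?_ (by simp [Prog.maxCost, Expr.cost])
    simp only [Prog.wp, Expr.Fits, Expr.val, State.setArr, hx, hy, Function.update_self]
    refine ⟨by omega, by omega, fun i => ?_, fun w v hv => ?_, fun v hv => ?_⟩
    · by_cases h : i = x
      · subst h
        simp
      · rw [Function.update_of_ne h]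
        exact hI.1 i
    · by_cases h : v = x
      · subst h
        rw [Function.update_self] at hv
        have : w = z := Fin.ext (by omega)
        rw [this]
        exact ((hadj z).2 v).mp (by simp [hpre])
      · rw [Function.update_of_ne (fun h' => h (Fin.ext h'))] at hv
        exact hI.2.1 w v hv
    · by_cases h : v = x
      · simp [h]
      · rw [Function.update_of_ne (fun h' => h (Fin.ext h'))]
        refine hI.2.2 v ?_
        simpa [h] using hv
  · rintro s' ⟨⟨h1, h2, h3⟩, hf⟩
    exact ⟨⟨hf.2 5 rfl ▸ ht.le_five, hf.2 6 rfl ▸ ht.le_six, h1, h2⟩, fun v =>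
      ⟨h2 z v, fun h => h3 v (((hadj z).2 v).mpr h)⟩⟩

theorem Ends.enqueueRoot {r : ℕ} {x : Fin n} (hs : Holds W adj u s) (ht : Tidy G s)
    (hm : ∀ v : Fin n, s.arr 2 v = 0) (hr : s.reg r = x) (hr' : r ≠ 7) :
    Ends W (SearchDiam.enqueueRoot r) s 11 fun s' => ∃ d a b, Queue n s' [x] d a b ∧ d x = 0 := by
  have hbd := hs.bound
  have hnn : 0 ≤ 2 * n * n := Nat.zero_le _
  have hx := x.2
  refine Ends.of_wp ?_ (by simp [SearchDiam.enqueueRoot, Prog.maxCost, Expr.cost])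
  simp only [SearchDiam.enqueueRoot, Prog.wp, Expr.Fits, Expr.val, State.setArr, State.setReg, hr,
    ne_eq, hr', not_false_eq_true, Function.update_of_ne]
  refine ⟨by omega, by omega, by omega, by omega, by omega, by omega, by omega,
    Function.update (s.arr 4) x 0, s.arr 5, s.arr 6, ⟨by simp, by simp, ?_, ?_, by simp, by simp,
    by simp, ?_, ht.le_five, ht.le_six⟩, by simp⟩
  · intro v
    by_cases h : v = x
    · simp [h]
    · have hne : (v : ℕ) ≠ x := fun h' => h (Fin.ext h')
      simp [h, Function.update_of_ne hne, hm]
  · intro i hi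
    have : i = 0 := by simpa using hi
    subst this
    simp
  · intro i hi
    have : i = 0 := by simpa using hi
    subst this
    simp

theorem Ends.searchFrom {r : ℕ} {x : Fin n} (t : Test)
    (J : ℕ → List (Fin n) → (ℕ → ℕ) → (ℕ → ℕ) → (ℕ → ℕ) → Prop)
    (hadj : IsAdjLists G adj) (hs : Holds W adj u s) (hT : Tidy G s)
    (hr : s.reg r = x) (hr' : SearchDiam.clear.writesReg r = false) (hr'' : r ≠ 7)
    (hJ₀ : ∀ d a b, d x = 0 → J 0 [x] d a b) (ht : t.cost ≤ 10)
    (hstep : ∀ (h : ℕ) (q : List (Fin n)) (d a b : ℕ → ℕ) (y : Fin n) (s' : State),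
      q[h]? = some y → q.Nodup → J h q d a b →
      Frame (SearchDiam.searchFrom r t) s s' → Holds W adj u s' → s'.reg 10 = y →
      s'.reg 11 = (fresh q (adj y)).length → s'.reg 7 = q.length →
      t.Fits W s' ∧ (t.Holds s' → J (h + 1) (q ++ fresh q (adj y))
        (override q (adj y) d fun _ => d y + 1)
        (override q (adj y) a fun i => if d y = 0 then i else a y)
        (override q (adj y) b fun i => if d y < 2 then i else b y)) ∧
        (¬ t.Holds s' → J (h + 1) q d a b)) :
    Ends W (SearchDiam.searchFrom r t) s (∑ v, (79 * (adj v).length + 66) + 21) fun s' =>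
      (∃ q d a b, Queue n s' q d a b ∧ J q.length q d a b) ∧ Tidy G s' ∧
        ∀ v : Fin n, s'.arr 10 v = 0 ∧ s'.arr 11 v = 0 := by
  have hsum : ∑ v, (79 * (adj v).length + 66) = ∑ v, (79 * (adj v).length + 50) + 16 * n := by
    simp only [Finset.sum_add_distrib, Finset.sum_const, Finset.card_univ, Fintype.card_fin,
      smul_eq_mul]
    ring
  refine ((Ends.clear hs).seq fun s₁ h₁ hf₁ => Ends.seq (Ends.enqueueRoot (hs.of_frame hf₁ rfl)
    (hT.of_frame hf₁ rfl) (fun v => (h₁ v).1) ((hf₁.1 r hr').trans hr) hr'') (T' :=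
      ∑ v, (79 * (adj v).length + 50) + 5) (Q := fun s' =>
      (∃ q d a b, Queue n s' q d a b ∧ J q.length q d a b) ∧ Tidy G s' ∧
        ∀ v : Fin n, s'.arr 10 v = 0 ∧ s'.arr 11 v = 0) ?_).mono ?_ fun _ h => h
  · rintro s₂ ⟨d, a, b, hq, hd⟩ hf₂
    have hf₀₂ : Frame (SearchDiam.searchFrom r t) s s₂ :=
      (hf₁.mono (by simp +contextual [SearchDiam.searchFrom, Prog.writesReg])
        (by simp +contextual [SearchDiam.searchFrom, Prog.writesArr])).trans
      (hf₂.mono (by simp +contextual [SearchDiam.searchFrom, Prog.writesReg])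
        (by simp +contextual [SearchDiam.searchFrom, Prog.writesArr]))
    refine (Ends.search t J (fun v => (hadj v).1) ((hs.of_frame hf₁ rfl).of_frame hf₂ rfl) hq
      (hJ₀ d a b hd) ht ?_).frame.mono le_rfl ?_
    · intro h q d a b y s' h1 h2 h3 hf
      exact hstep h q d a b y s' h1 h2 h3 (hf₀₂.trans
        (hf.mono (by simp +contextual [SearchDiam.searchFrom, Prog.writesReg])
          (by simp +contextual [SearchDiam.searchFrom, Prog.writesArr])))
    · rintro s₃ ⟨⟨q, d, a, b, hq, hJ⟩, hf₃⟩
      refine ⟨⟨q, d, a, b, hq, hJ⟩, ?_, fun v => ?_⟩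
      · have h9 : s₃.arr 9 = s.arr 9 := by rw [hf₃.2 9 rfl, hf₂.2 9 rfl, hf₁.2 9 rfl]
        exact ⟨hq.arr_five ▸ hq.le_five, hq.arr_six ▸ hq.le_six, h9 ▸ hT.le_nine, h9 ▸ hT.adj⟩
      · rw [hf₃.2 10 rfl, hf₂.2 10 rfl, hf₃.2 11 rfl, hf₂.2 11 rfl]
        exact (h₁ v).2
  · omega

/-! ### Breadth-first search with ancestors -/

/-- Breadth-first search from the vertex in register `r`. -/
def bfs (r : ℕ) : Prog := searchFrom r (.eq (.lit 0) (.lit 0))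

/-- The invariant of breadth-first search: `h` vertices of the queue have been expanded. -/
structure IsBFS (G : SimpleGraph (Fin n)) (r : Fin n) (h : ℕ) (q : List (Fin n)) (d a b : ℕ → ℕ) :
    Prop where
  root : r ∈ q
  dist_root : d r = 0
  closed : ∀ i < h, ∀ y : Fin n, q[i]? = some y → ∀ v, G.Adj y v → v ∈ q ∧ d v ≤ d y + 1
  mono : ∀ (i j : ℕ) (x y : Fin n), i ≤ j → q[i]? = some x → q[j]? = some y → d x ≤ d y
  front : ∀ y : Fin n, q[h]? = some y → ∀ v ∈ q, d v ≤ d y + 1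
  le_dist : ∀ v ∈ q, G.dist r v ≤ d v
  last : ∀ v ∈ q, v ≠ r → ∃ p p' : Fin n, a v = p ∧ b v = p' ∧ p' ∈ q ∧ a p' = p ∧ G.Adj r p ∧
    G.dist p v ≤ d v - 1 ∧ G.dist p' v ≤ d v - 2 ∧ (p' = p ∨ G.Adj p p')

theorem IsBFS.expand {r y : Fin n} {h : ℕ} (hc : G.Connected) (hadj : IsAdjLists G adj)
    (H : IsBFS G r h q d a b) (hy : q[h]? = some y) :
    IsBFS G r (h + 1) (q ++ fresh q (adj y)) (override q (adj y) d fun _ => d y + 1)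
      (override q (adj y) a fun i => if d y = 0 then i else a y)
      (override q (adj y) b fun i => if d y < 2 then i else b y) := by
  obtain ⟨hlt, hget⟩ := List.getElem?_eq_some_iff.mp hy
  have hyq : y ∈ q := hget ▸ List.getElem_mem hlt
  have hold : ∀ (f g : ℕ → ℕ) (v : Fin n), v ∈ q → override q (adj y) f g v = f v :=
    fun f g v hv => override_of_mem hv
  have hnew : ∀ (f g : ℕ → ℕ) (v : Fin n), v ∈ fresh q (adj y) →
    override q (adj y) f g v = g v := fun f g v hv => override_of_mem_fresh hv
  have hadjF : ∀ v ∈ fresh q (adj y), G.Adj y v := fun v hv =>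
    ((hadj y).2 v).mp (mem_fresh.mp hv).1
  have hge : ∀ {i x}, (q ++ fresh q (adj y))[i]? = some x →
      (i < q.length ∧ x ∈ q ∧ q[i]? = some x) ∨ (q.length ≤ i ∧ x ∈ fresh q (adj y)) := by
    intro i x hx
    rcases Nat.lt_or_ge i q.length with hi | hi
    · rw [List.getElem?_append_left hi] at hx
      exact Or.inl ⟨hi, List.mem_of_getElem? hx, hx⟩
    · rw [List.getElem?_append_right hi] at hx
      exact Or.inr ⟨hi, List.mem_of_getElem? hx⟩
  have hmono : ∀ (i j : ℕ) (x v : Fin n), i ≤ j → (q ++ fresh q (adj y))[i]? = some x →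
      (q ++ fresh q (adj y))[j]? = some v →
      override q (adj y) d (fun _ => d y + 1) x ≤ override q (adj y) d (fun _ => d y + 1) v := by
    intro i j x v hij hx hv
    rcases hge hx with ⟨hi, hxq, hx⟩ | ⟨hi, hxF⟩ <;> rcases hge hv with ⟨hj, hvq, hv⟩ | ⟨hj, hvF⟩
    · rw [hold _ _ x hxq, hold _ _ v hvq]
      exact H.mono i j x v hij hx hv
    · rw [hold _ _ x hxq, hnew _ _ v hvF]
      exact H.front y hy x hxq
    · omega
    · rw [hnew _ _ x hxF, hnew _ _ v hvF]
  refine ⟨List.mem_append_left _ H.root, by rw [hold _ _ r H.root, H.dist_root], ?_, hmono, ?_, ?_,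
    ?_⟩
  · intro i hi x hx v hv
    rcases Nat.lt_or_ge i h with hih | hih
    · rcases hge hx with ⟨-, hxq, hx⟩ | ⟨h', -⟩
      · obtain ⟨h1, h2⟩ := H.closed i hih x hx v hv
        rw [hold _ _ x hxq, hold _ _ v h1]
        exact ⟨List.mem_append_left _ h1, h2⟩
      · omega
    · have : i = h := by omega
      subst this
      have hxy : x = y := by
        rw [List.getElem?_append_left hlt, hy] at hx
        exact (Option.some.inj hx).symm
      subst hxy
      have hvl : v ∈ adj x := ((hadj x).2 v).mpr hv
      refine ⟨mem_append_fresh.mpr (Or.inr hvl), ?_⟩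
      rw [hold _ _ x hyq]
      by_cases hvq : v ∈ q
      · rw [hold _ _ v hvq]
        exact H.front x hy v hvq
      · rw [hnew _ _ v (mem_fresh.mpr ⟨hvl, hvq⟩)]
  · intro x hx v hv
    have h1 := hmono h (h + 1) y x (by omega) (by rw [List.getElem?_append_left hlt, hy]) hx
    rw [hold _ _ y hyq] at h1
    rcases List.mem_append.mp hv with hvq | hvF
    · rw [hold _ _ v hvq]
      have := H.front y hy v hvq
      omega
    · rw [hnew _ _ v hvF]
      omega
  · intro v hv
    rcases List.mem_append.mp hv with hvq | hvF
    · rw [hold _ _ v hvq]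
      exact H.le_dist v hvq
    · rw [hnew _ _ v hvF]
      have h1 := H.le_dist y hyq
      have h2 := dist_le_succ_of_adj hc (a := r) (hadjF v hvF)
      omega
  · intro v hv hvr
    rcases List.mem_append.mp hv with hvq | hvF
    · obtain ⟨p, p', h1, h2, h3, h4, h5⟩ := H.last v hvq hvr
      refine ⟨p, p', ?_, ?_, List.mem_append_left _ h3, ?_, ?_⟩
      · rw [hold _ _ v hvq, h1]
      · rw [hold _ _ v hvq, h2]
      · rw [hold _ _ p' h3, h4]
      · rw [hold _ _ v hvq]
        exact h5
    · have hyv := hadjF v hvF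
      rw [hnew _ _ v hvF, hnew _ _ v hvF, hnew _ _ v hvF]
      have hy0 := H.le_dist y hyq
      -- A child v of the root is its own ancestor in both arrays. If y has distance 1, then y is
      -- the first ancestor of v and v its own second one. Otherwise v inherits both from y.
      rcases Nat.eq_zero_or_pos (d y) with h0 | h0
      · have hry : r = y := by
          rw [h0, Nat.le_zero, hc.dist_eq_zero_iff] at hy0
          exact hy0
        refine ⟨v, v, by simp [h0], by simp [h0], hv, ?_, hry ▸ hyv, by simp, by simp, Or.inl rfl⟩
        rw [hnew _ _ v hvF]
        simp [h0]
      · have hyr : y ≠ r := by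
          rintro rfl
          rw [H.dist_root] at h0
          omega
        obtain ⟨p, p', h1, h2, h3, h4, h5, h6, h7, h8⟩ := H.last y hyq hyr
        have h9 := dist_le_succ_of_adj hc (a := p) hyv
        rcases Nat.lt_or_ge (d y) 2 with h2' | h2'
        · have hpy : p = y := by
            rw [show d y - 1 = 0 by omega, Nat.le_zero, hc.dist_eq_zero_iff] at h6
            exact h6
          refine ⟨p, v, by simp [h0.ne', h1], by simp [h2'], hv, ?_, h5, by omega, by simp,
            Or.inr (hpy ▸ hyv)⟩
          rw [hnew _ _ v hvF]
          simp [h0.ne', h1]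
        · have h10 := dist_le_succ_of_adj hc (a := p') hyv
          refine ⟨p, p', by simp [h0.ne', h1], by simp [Nat.not_lt.mpr h2', h2],
            List.mem_append_left _ h3, ?_, h5, by omega, by omega, h8⟩
          rw [hold _ _ p' h3, h4]

theorem mem_of_closed (hc : G.Connected) {r : Fin n} {Q : Set (Fin n)} (hr : r ∈ Q)
    (hQ : ∀ y ∈ Q, ∀ v, G.Adj y v → v ∈ Q) (v : Fin n) : v ∈ Q := by
  obtain ⟨p⟩ := hc r v
  induction p with
  | nil => exact hr
  | cons h _ ih => exact ih (hQ _ hr _ h)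

/-- The invariant gives one inequality. As every vertex has been expanded, d grows by at most 1
along each edge of a shortest path, which gives the other. -/
theorem IsBFS.dist_eq {r : Fin n} (hc : G.Connected) (H : IsBFS G r q.length q d a b)
    (v : Fin n) : v ∈ q ∧ d v = G.dist r v := by
  have hcl : ∀ y ∈ q, ∀ v, G.Adj y v → v ∈ q ∧ d v ≤ d y + 1 := by
    intro y hy
    obtain ⟨i, hi, rfl⟩ := List.getElem_of_mem hy
    exact H.closed i hi _ (List.getElem?_eq_getElem hi)
  have hmem := mem_of_closed hc (Q := {v | v ∈ q}) H.root fun y hy v hv => (hcl y hy v hv).1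
  refine ⟨hmem v, le_antisymm ?_ (H.le_dist v (hmem v))⟩
  have key : ∀ l v, G.dist r v = l → d v ≤ l := by
    intro l
    induction l with
    | zero =>
      intro v hv
      rw [hc.dist_eq_zero_iff] at hv
      rw [← hv, H.dist_root]
    | succ l ih =>
      intro v hv
      obtain ⟨c, hcv, hrc⟩ := exists_adj_dist_eq hc hv
      have h1 := ih c hrc
      have h2 := (hcl c (hmem c) v hcv).2
      omega
  exact key _ v rfl

theorem Ends.bfs {r : ℕ} {x : Fin n} (hc : G.Connected) (hadj : IsAdjLists G adj)
    (hs : Holds W adj u s) (hT : Tidy G s) (hr : s.reg r = x)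
    (hr' : SearchDiam.clear.writesReg r = false) (hr'' : r ≠ 7) :
    Ends W (SearchDiam.bfs r) s (∑ v, (79 * (adj v).length + 66) + 21) fun s' =>
      Tidy G s' ∧ (∀ v : Fin n, s'.arr 10 v = 0 ∧ s'.arr 11 v = 0) ∧
      (∀ v : Fin n, s'.arr 4 v = G.dist x v) ∧
      ∀ v : Fin n, v ≠ x → ∃ p p' : Fin n, s'.arr 5 v = p ∧ s'.arr 6 v = p' ∧ s'.arr 5 p' = p ∧
        Last G x v p p' := by
  have hbd := hs.bound
  refine (Ends.searchFrom _ (fun h q d a b => IsBFS G x h q d a b) hadj hs hT hr hr' hr'' ?_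
    (by decide) ?_).mono le_rfl ?_
  · intro d a b hd
    refine ⟨by simp, hd, by simp, ?_, ?_, ?_, ?_⟩
    · intro i j y z hij hy hz
      have hy := List.mem_of_getElem? hy
      have hz := List.mem_of_getElem? hz
      rw [List.mem_singleton] at hy hz
      rw [hy, hz]
    · intro y hy v hv
      have hy := List.mem_of_getElem? hy
      rw [List.mem_singleton] at hy hv
      rw [hy, hv]
      omega
    · intro v hv
      rw [List.mem_singleton] at hv
      simp [hv]
    · intro v hv hvx
      exact absurd (List.mem_singleton.mp hv) hvx
  · intro h q d a b y s' hy _ hJ _ _ _ _ _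
    refine ⟨?_, fun _ => hJ.expand hc hadj hy, fun h => absurd rfl h⟩
    simp only [Test.Fits, Expr.Fits]
    omega
  · rintro s' ⟨⟨q, d, a, b, hq, hJ⟩, hT', hz⟩
    refine ⟨hT', hz, fun v => ?_, fun v hv => ?_⟩
    · rw [hq.arr_four, (hJ.dist_eq hc v).2]
    · obtain ⟨p, p', h1, h2, h3, h4, h5, h6, h7, h8⟩ := hJ.last v (hJ.dist_eq hc v).1 hv
      rw [(hJ.dist_eq hc v).2] at h6 h7
      exact ⟨p, p', by rw [hq.arr_five, h1], by rw [hq.arr_six, h2], by rw [hq.arr_five, h4],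
        h5, h6, h7, h8⟩

end

section

variable {n W : ℕ} {G : SimpleGraph (Fin n)} {adj : Fin n → List (Fin n)} {u : Fin n} {s : State}
  {q : List (Fin n)} {d a b : ℕ → ℕ}

/-! ### Finding an extremity -/

/-- Find an extremity that is separated from the given vertex by the neighbours of the vertex in
register `5`, and store it in register `12`. -/
def findExtremity : Prog :=
  .seq (stamp 5) (.seq (searchFrom 1 (.not (.eq (.read 9 (.reg 10)) (.add (.reg 5) (.lit 1)))))
    (.seq (search (.lt (.add (.reg 11) (.reg 7)) (.reg 0)))
      (forBelow 13 (.cond (.eq (.read 2 (.reg 13)) (.lit 0)) (.setReg 12 (.reg 13)) .nop))))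

/-- The invariant of the search from `u` that does not expand neighbours of `z`. -/
structure Avoids (G : SimpleGraph (Fin n)) (u z : Fin n) (h : ℕ) (q : List (Fin n)) : Prop where
  notMem : z ∉ q
  root : u ∈ q
  closed : ∀ i < h, ∀ y : Fin n, q[i]? = some y → ¬ G.Adj z y → ∀ v, G.Adj y v → v ∈ q
  link : ∀ v ∈ q, ¬ G.Adj z v → Link G {y | y ∈ q ∧ ¬ G.Adj z y} u v
  parent : ∀ v ∈ q, v = u ∨ ∃ y ∈ q, ¬ G.Adj z y ∧ G.Adj y v

/-- The invariant of the search that expands a vertex of the queue only if this leaves a vertex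
that is not in the queue; `K` is the set of expanded vertices. -/
structure Grows (G : SimpleGraph (Fin n)) (u : Fin n) (q₁ : List (Fin n)) (K : Set (Fin n)) (h : ℕ)
    (q : List (Fin n)) : Prop where
  root : u ∈ K
  sub : ∀ v ∈ q₁, v ∈ q
  mem : ∀ y ∈ K, y ∈ q
  closed : ∀ y ∈ K, ∀ v, G.Adj y v → v ∈ q
  link : ∀ v ∈ K, Link G K u v
  parent : ∀ v ∈ q, v ∈ K ∨ ∃ y ∈ K, G.Adj y v
  proper : ∃ v, v ∉ q
  maximal : ∀ i < h, ∀ y : Fin n, q[i]? = some y → y ∈ K ∨ ∀ v, v ∉ q → G.Adj y v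

/-- Only non-neighbours of z are expanded, so z never enters the queue. -/
theorem Avoids.expand {z y : Fin n} {h : ℕ} (hadj : IsAdjLists G adj) (H : Avoids G u z h q)
    (hy : q[h]? = some y) (hzy : ¬ G.Adj z y) : Avoids G u z (h + 1) (q ++ fresh q (adj y)) := by
  obtain ⟨hlt, hget⟩ := List.getElem?_eq_some_iff.mp hy
  have hyq : y ∈ q := hget ▸ List.getElem_mem hlt
  have hsub : {x | x ∈ q ∧ ¬ G.Adj z x} ⊆ {x | x ∈ q ++ fresh q (adj y) ∧ ¬ G.Adj z x} :=
    fun x hx => ⟨List.mem_append_left _ hx.1, hx.2⟩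
  refine ⟨?_, List.mem_append_left _ H.root, ?_, ?_, ?_⟩
  · rw [mem_append_fresh, (hadj y).2]
    rintro (h | h)
    · exact H.notMem h
    · exact hzy h.symm
  · intro i hi x hx hzx v hv
    rw [mem_append_fresh, (hadj y).2]
    rw [List.getElem?_append_left (by omega)] at hx
    rcases Nat.lt_or_ge i h with hih | hih
    · exact Or.inl (H.closed i hih x hx hzx v hv)
    · have : i = h := by omega
      subst this
      rw [hy] at hx
      exact Or.inr (Option.some.inj hx ▸ hv)
  · intro v hv hzv
    have hv' := hv
    rw [mem_append_fresh, (hadj y).2] at hv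
    rcases hv with hv | hv
    · exact (H.link v hv hzv).mono hsub
    · exact ((H.link y hyq hzy).mono hsub).tail ⟨hv, hv', hzv⟩
  · intro v hv
    rw [mem_append_fresh, (hadj y).2] at hv
    rcases hv with hv | hv
    · exact (H.parent v hv).imp_right fun ⟨x, hx, h⟩ => ⟨x, List.mem_append_left _ hx, h⟩
    · exact Or.inr ⟨y, List.mem_append_left _ hyq, hzy, hv⟩

theorem Avoids.skip {z y : Fin n} {h : ℕ} (H : Avoids G u z h q) (hy : q[h]? = some y)
    (hzy : G.Adj z y) : Avoids G u z (h + 1) q := by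
  refine ⟨H.notMem, H.root, ?_, H.link, H.parent⟩
  intro i hi x hx hzx v hv
  rcases Nat.lt_or_ge i h with hih | hih
  · exact H.closed i hih x hx hzx v hv
  · have : i = h := by omega
    subst this
    rw [hy] at hx
    exact absurd (Option.some.inj hx ▸ hzy) hzx

theorem Avoids.mem_of_adj {z y v : Fin n} (H : Avoids G u z q.length q) (hy : y ∈ q)
    (hzy : ¬ G.Adj z y) (hv : G.Adj y v) : v ∈ q := by
  obtain ⟨i, hi, rfl⟩ := List.getElem_of_mem hy
  exact H.closed i hi _ (List.getElem?_eq_getElem hi) hzy v hv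

/-- The second search rereads the same queue from its head, hence h = 0; K starts as the set of
vertices already expanded. -/
theorem Avoids.grows {z : Fin n} (H : Avoids G u z q.length q) (hzu : ¬ G.Adj z u) :
    Grows G u q {y | y ∈ q ∧ ¬ G.Adj z y} 0 q := by
  refine ⟨⟨H.root, hzu⟩, fun v hv => hv, fun y hy => hy.1, fun y hy v hv =>
    H.mem_of_adj hy.1 hy.2 hv, fun v hv => H.link v hv.1 hv.2, ?_, ⟨z, H.notMem⟩, by simp⟩
  intro v hv
  rcases H.parent v hv with rfl | ⟨y, hy, h1, h2⟩
  · exact Or.inl ⟨hv, hzu⟩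
  · exact Or.inr ⟨y, ⟨hy, h1⟩, h2⟩

theorem Grows.expand {q₁ : List (Fin n)} {K : Set (Fin n)} {y : Fin n} {h : ℕ}
    (hadj : IsAdjLists G adj) (H : Grows G u q₁ K h q) (hy : q[h]? = some y)
    (hlt : (q ++ fresh q (adj y)).length < n) :
    Grows G u q₁ (insert y K) (h + 1) (q ++ fresh q (adj y)) := by
  obtain ⟨hlen, hget⟩ := List.getElem?_eq_some_iff.mp hy
  have hyq : y ∈ q := hget ▸ List.getElem_mem hlen
  have hmono := Set.subset_insert y K
  refine ⟨Or.inr H.root, fun v hv => List.mem_append_left _ (H.sub v hv), ?_, ?_, ?_, ?_, ?_, ?_⟩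
  · rintro x (rfl | hx)
    · exact List.mem_append_left _ hyq
    · exact List.mem_append_left _ (H.mem x hx)
  · rintro x (rfl | hx) v hv
    · rw [mem_append_fresh, (hadj x).2]
      exact Or.inr hv
    · exact List.mem_append_left _ (H.closed x hx v hv)
  · rintro v (rfl | hv)
    · rcases H.parent v hyq with hv | ⟨x, hx, hxv⟩
      · exact (H.link v hv).mono hmono
      · exact ((H.link x hx).mono hmono).tail ⟨hxv, Set.mem_insert _ _⟩
    · exact (H.link v hv).mono hmono
  · intro v hv
    rw [mem_append_fresh, (hadj y).2] at hv
    rcases hv with hv | hv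
    · exact (H.parent v hv).imp Or.inr fun ⟨x, hx, h⟩ => ⟨x, Or.inr hx, h⟩
    · exact Or.inr ⟨y, Set.mem_insert _ _, hv⟩
  · by_contra hcon
    push Not at hcon
    have h1 : (Finset.univ : Finset (Fin n)) ⊆ (q ++ fresh q (adj y)).toFinset :=
      fun v _ => List.mem_toFinset.mpr (hcon v)
    have h2 := (Finset.card_le_card h1).trans (List.toFinset_card_le _)
    rw [Finset.card_univ, Fintype.card_fin] at h2
    omega
  -- A rejected vertex is adjacent to everything outside the queue, and this persists as the queue
  -- grows.
  · intro i hi x hx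
    rw [List.getElem?_append_left (by omega)] at hx
    rcases Nat.lt_or_ge i h with hih | hih
    · exact (H.maximal i hih x hx).imp Or.inr fun h v hv =>
        h v fun hv' => hv (List.mem_append_left _ hv')
    · have : i = h := by omega
      subst this
      rw [hy] at hx
      exact Or.inl (Option.some.inj hx ▸ Set.mem_insert _ _)

/-- If the new neighbours of y would fill up the vertex set, then y is adjacent to every vertex
outside the queue. -/
theorem Grows.skip {q₁ : List (Fin n)} {K : Set (Fin n)} {y : Fin n} {h : ℕ}
    (hadj : IsAdjLists G adj) (hnd : q.Nodup) (H : Grows G u q₁ K h q) (hy : q[h]? = some y)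
    (hge : n ≤ (fresh q (adj y)).length + q.length) : Grows G u q₁ K (h + 1) q := by
  refine ⟨H.root, H.sub, H.mem, H.closed, H.link, H.parent, H.proper, ?_⟩
  intro i hi x hx
  rcases Nat.lt_or_ge i h with hih | hih
  · exact H.maximal i hih x hx
  · have : i = h := by omega
    subst this
    rw [hy] at hx
    obtain rfl := Option.some.inj hx
    refine Or.inr fun v hv => ?_
    have hnd' : (q ++ fresh q (adj y)).Nodup := by
      rw [List.nodup_append]
      refine ⟨hnd, (hadj y).1.filter _, ?_⟩
      rintro a ha b hb rfl
      exact (mem_fresh.mp hb).2 ha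
    have hcard : (q ++ fresh q (adj y)).toFinset = Finset.univ := by
      apply Finset.eq_univ_of_card
      rw [List.toFinset_card_of_nodup hnd', Fintype.card_fin]
      have := hnd'.length_le_card
      rw [Fintype.card_fin] at this
      rw [List.length_append] at *
      omega
    have : v ∈ q ++ fresh q (adj y) := by
      rw [← List.mem_toFinset, hcard]
      exact Finset.mem_univ v
    rw [mem_append_fresh, (hadj y).2] at this
    exact this.resolve_left hv

theorem Grows.isExtremity {q₁ : List (Fin n)} {K : Set (Fin n)} {w : Fin n} (hG : IsPrime G)
    (H : Grows G u q₁ K q.length q) (hw : w ∉ q) : IsExtremity G w := by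
  refine isExtremity_of_dominated hG (Q := {v | v ∈ q}) H.root H.mem H.closed H.link ?_ hw
  intro y hy
  obtain ⟨i, hi, rfl⟩ := List.getElem_of_mem hy
  exact H.maximal i hi _ (List.getElem?_eq_getElem hi)

/-- The final queue contains all that z covers and is not everything; by primality its complement is
a single extremity, which the last loop finds as an unmarked vertex. -/
theorem Ends.findExtremity {z : Fin n} (hG : IsPrime G) (hadj : IsAdjLists G adj)
    (hs : Holds W adj u s) (hT : Tidy G s) (h5 : s.reg 5 = z) (hzu : ¬ G.Adj z u) (hne : z ≠ u) :
    Ends W SearchDiam.findExtremity s (∑ v, (176 * (adj v).length + 133) + 45) fun s' =>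
      Tidy G s' ∧ ∃ w : Fin n, s'.reg 12 = w ∧ IsExtremity G w ∧ ¬ Covers G u z w := by
  have hbd := hs.bound
  have hnn : 0 ≤ 2 * n * n := Nat.zero_le _
  have hz := z.2
  have hsum : (18 * (adj z).length + 9) + ((∑ v, (79 * (adj v).length + 66) + 21) +
      ((∑ v, (79 * (adj v).length + 50) + 5) + (∑ _v : Fin n, (10 + 7) + 5))) ≤
      ∑ v, (176 * (adj v).length + 133) + 45 := by
    have h1 : (adj z).length ≤ ∑ v, (adj v).length :=
      Finset.single_le_sum (f := fun v => (adj v).length) (fun _ _ => Nat.zero_le _)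
        (Finset.mem_univ z)
    simp only [Finset.sum_add_distrib, ← Finset.mul_sum, Finset.sum_const, Finset.card_univ,
      Fintype.card_fin, smul_eq_mul]
    omega
  refine Ends.mono (Ends.seq (Ends.stamp hadj hs hT h5 (by decide) (by decide)) ?_) hsum
    fun _ h => h
  rintro s₁ ⟨hT₁, hst⟩ hf₁
  have hs₁ := hs.of_frame hf₁ rfl
  have h5₁ : s₁.reg 5 = z := (hf₁.1 5 rfl).trans h5
  refine Ends.seq (Ends.searchFrom _ (fun h q _ _ _ => Avoids G u z h q) hadj hs₁ hT₁ hs₁.reg_one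
    rfl (by decide) ?_ (by decide) ?_) ?_
  · intro d a b _
    refine ⟨by simpa using hne, by simp, by simp, ?_, ?_⟩
    · intro v hv _
      rw [List.mem_singleton.mp hv]
      exact .refl
    · intro v hv
      exact Or.inl (List.mem_singleton.mp hv)
  · intro h q d a b y s' hy _ hJ hf hs' h10 _ _
    have h9 : s'.arr 9 = s₁.arr 9 := hf.2 9 rfl
    have h5' : s'.reg 5 = z := (hf.1 5 rfl).trans h5₁
    have hyn := y.2
    have hle := hT₁.le_nine y
    simp only [Test.Fits, Test.Holds, Expr.Fits, Expr.val, h9, h5', h10, hst y, not_not]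
    exact ⟨by omega, hJ.expand hadj hy, hJ.skip hy⟩
  rintro s₂ ⟨⟨q₁, d₁, a₁, b₁, hq₁, hJ₁⟩, hT₂, -⟩ hf₂
  have hs₂ := hs₁.of_frame hf₂ rfl
  refine Ends.seq (Ends.search _ (fun h q _ _ _ => ∃ K, Grows G u q₁ K h q) (fun v => (hadj v).1)
    hs₂ hq₁ ⟨_, hJ₁.grows hzu⟩ (by decide) ?_).frame ?_
  · rintro h q d a b y s' hy hnd ⟨K, hJ⟩ hf hs' h10 h11 h7
    have hlen := hnd.length_le_card
    have hlen' := (List.length_filter_le (fun v => decide (v ∉ q)) (adj y)).trans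
      (hadj y).1.length_le_card
    rw [Fintype.card_fin] at hlen hlen'
    simp only [Test.Fits, Test.Holds, Expr.Fits, Expr.val, h11, h7, hs'.reg_zero]
    refine ⟨?_, fun hlt => ⟨_, hJ.expand hadj hy ?_⟩, fun hge => ⟨K, hJ.skip hadj hnd hy (by omega)⟩⟩
    · simp only [fresh]
      omega
    · rw [List.length_append]
      omega
  rintro s₃ ⟨⟨q, d, a, b, hq, K, hJ⟩, hf₃⟩ -
  have hs₃ := hs₂.of_frame hf₃ rfl
  have hT₃ : Tidy G s₃ := by
    have h9 : s₃.arr 9 = s₂.arr 9 := hf₃.2 9 rfl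
    exact ⟨hq.arr_five ▸ hq.le_five, hq.arr_six ▸ hq.le_six, h9 ▸ hT₂.le_nine, h9 ▸ hT₂.adj⟩
  refine (Ends.forBelow (fun j s' => ∀ v : Fin n, (v : ℕ) < j → v ∉ q →
    ∃ w : Fin n, w ∉ q ∧ s'.reg 12 = w) (fun _ => 10) hs₃.reg_zero (by omega) (by decide) rfl rfl
    ?_ ?_ (by simp)).frame.mono le_rfl ?_
  · intro j s' k hI v hv hvq
    obtain ⟨w, hw, hw'⟩ := hI v hv hvq
    exact ⟨w, hw, by simpa [State.setReg] using hw'⟩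
  · intro j s' hf hI hj
    have hjn := j.2
    have hm : s'.arr 2 j = if j ∈ q then 1 else 0 := by rw [hf.2 2 rfl, hq.mark]
    refine Ends.of_wp ?_ (by decide)
    by_cases hjq : j ∈ q
    · simp only [Prog.wp, Test.Fits, Test.Holds, Expr.Fits, Expr.val, hj, hm, hjq, if_true]
      refine ⟨by omega, fun h => absurd h one_ne_zero, fun _ v hv hvq => hI v ?_ hvq⟩
      have : v ≠ j := fun h => hvq (h ▸ hjq)
      have : (v : ℕ) ≠ j := fun h => this (Fin.ext h)
      omega
    · simp only [Prog.wp, Test.Fits, Test.Holds, Expr.Fits, Expr.val, hj, hm, hjq, if_false,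
        State.setReg, Function.update_self]
      exact ⟨by omega, fun _ => ⟨by omega, fun v _ _ => ⟨j, hjq, rfl⟩⟩, fun h => absurd trivial h⟩
  · rintro s₄ ⟨h, hf₄⟩
    obtain ⟨v, hv⟩ := hJ.proper
    obtain ⟨w, hw, hw'⟩ := h v v.2 hv
    refine ⟨hT₃.of_frame hf₄ rfl, w, hw', hJ.isExtremity hG hw, fun hcov => hw (hJ.sub w ?_)⟩
    exact hcov.mem (Q := {v | v ∈ q₁}) hJ₁.root hzu fun y hy hzy v hv => hJ₁.mem_of_adj hy hzy hv

end

section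

variable {n W : ℕ} {G : SimpleGraph (Fin n)} {adj : Fin n → List (Fin n)} {u : Fin n} {s : State}

/-! ### Using an extremity -/

/-- Compare the distances between the extremity and the neighbours of the given vertex with the
number in register `2`, and count how often each vertex is an ancestor of such a neighbour. -/
def tally : Prog :=
  forNbr 1 8 9 (.seq (.cond (.lt (.reg 2) (.read 4 (.reg 9)))
      (.seq (.setReg 3 (.reg 9)) (.setReg 4 (.add (.reg 2) (.lit 1)))) .nop)
    (.seq (.setArr 10 (.read 5 (.reg 9)) (.add (.read 10 (.read 5 (.reg 9))) (.lit 1)))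
      (.setArr 11 (.read 6 (.reg 9)) (.add (.read 11 (.read 6 (.reg 9))) (.lit 1)))))

/-- Add to register `11` the number of neighbours of the given vertex that have an ancestor
adjacent to the vertex in register `13`. -/
def countHit : Prog :=
  forNbr 13 8 9 (.seq (.setReg 11 (.add (.reg 11) (.read 10 (.reg 9))))
    (.cond (.eq (.read 9 (.read 5 (.reg 9))) (.add (.reg 13) (.lit 1))) .nop
      (.setReg 11 (.add (.reg 11) (.read 11 (.reg 9))))))

/-- Find the vertices that are adjacent to an ancestor of each neighbour of the given vertex. -/
def check : Prog :=
  forBelow 13 (.seq (stamp 13) (.seq (.setReg 11 (.lit 0)) (.seq countHit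
    (.cond (.eq (.reg 11) (.sub (.read 0 (.add (.reg 1) (.lit 1))) (.read 0 (.reg 1))))
      (.setArr 8 (.reg 13) (.lit 1)) .nop))))

/-- One round of the main loop. -/
def round : Prog := .seq findExtremity (.seq (bfs 12) (.seq tally check))

theorem Ends.tally {w : Fin n} {e : ℕ} {P P' : Fin n → Fin n} (hadj : IsAdjLists G adj)
    (hs : Holds W adj u s) (he : s.reg 2 = e) (hen : e ≤ n) (hd : ∀ v : Fin n, s.arr 4 v = G.dist w v)
    (hdn : ∀ v, G.dist w v ≤ n) (hP : ∀ x, G.Adj u x → s.arr 5 x = P x ∧ s.arr 6 x = P' x)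
    (h0 : ∀ v : Fin n, s.arr 10 v = 0 ∧ s.arr 11 v = 0) :
    Ends W SearchDiam.tally s (50 * (adj u).length + 9) fun s' =>
      (∀ v : Fin n, s'.arr 10 v = ((adj u).map P).count v ∧
        s'.arr 11 v = ((adj u).map P').count v) ∧
      ((∃ x, G.Adj u x ∧ e < G.dist w x ∧ s'.reg 3 = x ∧ s'.reg 4 = e + 1) ∨
        ((∀ x, G.Adj u x → G.dist w x ≤ e) ∧ s'.reg 3 = s.reg 3 ∧ s'.reg 4 = s.reg 4)) := by
  have hbd := hs.bound
  have hnn : 0 ≤ 2 * n * n := Nat.zero_le _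
  refine (Ends.forNbr hs (fun l s' => (∀ v : Fin n, s'.arr 10 v = (l.map P).count v ∧
        s'.arr 11 v = (l.map P').count v) ∧
      ((∃ x, G.Adj u x ∧ e < G.dist w x ∧ s'.reg 3 = x ∧ s'.reg 4 = e + 1) ∨
        ((∀ x ∈ l, G.dist w x ≤ e) ∧ s'.reg 3 = s.reg 3 ∧ s'.reg 4 = s.reg 4))) 37 u hs.reg_one rfl
    (fun l s k h => ⟨by simpa [State.setReg] using h, by simpa [State.setReg] using h⟩) ?_ ?_).mono
    (by omega) ?_
  · intro pre x post s' hpre hf hs' hy hx ⟨hI, hI'⟩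
    have h4 : s'.arr 4 = s.arr 4 := hf.2 4 rfl
    have h5 : s'.arr 5 = s.arr 5 := hf.2 5 rfl
    have h6 : s'.arr 6 = s.arr 6 := hf.2 6 rfl
    have h2 : s'.reg 2 = e := (hf.1 2 rfl).trans he
    have hux : G.Adj u x := ((hadj u).2 x).mp (by simp [hpre])
    have hxn := x.2
    have hpn := (P x).2
    have hpn' := (P' x).2
    have hdx := hdn x
    have hlen : pre.length + 1 ≤ n := by
      have h1 := congrArg List.length hpre
      have h2 := (hadj u).1.length_le_card
      rw [Fintype.card_fin] at h2
      simp only [List.length_append, List.length_cons] at h1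
      omega
    have hc : ∀ (f : Fin n → Fin n) v, (pre.map f).count v ≤ pre.length := fun f v =>
      List.count_le_length.trans_eq (List.length_map _)
    have hc1 := hc P (P x)
    have hc2 := hc P' (P' x)
    -- Arrays are indexed by all natural numbers, so the count is extended by 0 to express the store
    -- as an update.
    have hcnt : ∀ (f : Fin n → Fin n) (v : Fin n), ((pre ++ [x]).map f).count v =
        Function.update (fun i : ℕ => if h : i < n then (pre.map f).count ⟨i, h⟩ else 0) (f x)
          ((pre.map f).count (f x) + 1) v := by
      intro f v
      by_cases hv : v = f x
      · subst hv
        simp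
      · rw [Function.update_of_ne (fun h => hv (Fin.ext h))]
        simp [Ne.symm hv]
    have hupd : ∀ v : Fin n,
        Function.update (s'.arr 10) (P x) ((pre.map P).count (P x) + 1) v =
          ((pre ++ [x]).map P).count v ∧
        Function.update (s'.arr 11) (P' x) ((pre.map P').count (P' x) + 1) v =
          ((pre ++ [x]).map P').count v := by
      intro v
      rw [hcnt, hcnt]
      simp only [Function.update_apply, hI, v.2, dite_true, Fin.eta]
      exact ⟨trivial, trivial⟩
    refine Ends.of_wp ?_ (by decide)
    simp only [Prog.wp, Test.Fits, Test.Holds, Expr.Fits, Expr.val, State.setReg, State.setArr,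
      Function.update_self, hx, h2, h4, h5, h6, hd, (hP x hux).1, (hP x hux).2, ne_eq,
      Nat.reduceEqDiff, not_false_eq_true, Function.update_of_ne, hI]
    refine ⟨by omega, fun hlt => ⟨by omega, by omega, by omega, by omega, by omega, by omega,
      hupd, Or.inl ⟨x, hux, hlt, rfl, trivial⟩⟩, fun hge => ⟨by omega, by omega, by omega, by omega,
      hupd, ?_⟩⟩
    refine hI'.imp (fun h => h) fun h => ⟨?_, h.2⟩
    intro v hv
    rcases List.mem_append.mp hv with hv | hv
    · exact h.1 v hv
    · rw [List.mem_singleton.mp hv]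
      omega
  · exact ⟨by simpa using h0, Or.inr ⟨by simp, rfl, rfl⟩⟩
  · rintro s' ⟨h1, h2⟩
    exact ⟨h1, h2.imp (fun h => h) fun h => ⟨fun x hx => h.1 x (((hadj u).2 x).mpr hx), h.2⟩⟩

/-- An x contributes once at P x if this is in A, and once at P' x if this is in A but P x is not;
so no x is counted twice. By `hB`, the second condition can be read off from P' x alone, and the sum
costs one step per element of A rather than per pair. -/
theorem sum_count_add_eq_countP {α β : Type*} [DecidableEq β] (X : List α) (A : List β)
    (hA : A.Nodup) (P P' : α → β) (B : β → Prop) [DecidablePred B]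
    (hB : ∀ x ∈ X, B (P' x) ↔ P x ∈ A) :
    (A.map fun y => (X.map P).count y + if B y then 0 else (X.map P').count y).sum =
      X.countP fun x => P x ∈ A ∨ P' x ∈ A := by
  rw [← List.sum_toFinset _ hA]
  induction X with
  | nil => simp
  | cons x X ih =>
    have ih := ih fun x hx => hB x (List.mem_cons_of_mem _ hx)
    have hx := hB x List.mem_cons_self
    rw [List.countP_cons, ← ih]
    have : ∀ y, ((x :: X).map P).count y + (if B y then 0 else ((x :: X).map P').count y) =
        ((X.map P).count y + if B y then 0 else (X.map P').count y) +
          ((if P x = y then 1 else 0) + if P' x = y then (if P x ∈ A then 0 else 1) else 0) := by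
      intro y
      simp only [List.map_cons, List.count_cons, beq_iff_eq]
      by_cases hy : P' x = y
      · subst hy
        by_cases h : P x ∈ A
        · simp [h, hx.mpr h]
        · simp [h, hx.not.mpr h]
          omega
      · simp [hy]
        omega
    simp only [this, Finset.sum_add_distrib, Finset.sum_ite_eq, List.mem_toFinset]
    by_cases h : P x ∈ A <;> by_cases h' : P' x ∈ A <;> simp [h, h']

open Classical in
theorem Ends.countHit {v : Fin n} {P P' : Fin n → Fin n} (hadj : IsAdjLists G adj)
    (hs : Holds W adj u s) (hT : Tidy G s) (hv : s.reg 13 = v) (h11 : s.reg 11 = 0)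
    (hP : ∀ x, G.Adj u x → s.arr 5 (P' x) = P x)
    (hcnt : ∀ y : Fin n, s.arr 10 y = ((adj u).map P).count y ∧
        s.arr 11 y = ((adj u).map P').count y)
    (hst : ∀ y : Fin n, s.arr 9 y = v + 1 ↔ G.Adj v y) :
    Ends W SearchDiam.countHit s (38 * (adj v).length + 9) fun s' =>
      s'.reg 11 = (adj u).countP fun x => G.Adj v (P x) ∨ G.Adj v (P' x) := by
  have hbd := hs.bound
  have hvn := v.2
  set f : Fin n → ℕ := fun y => ((adj u).map P).count y +
    if s.arr 9 (s.arr 5 y) = v + 1 then 0 else ((adj u).map P').count y with hf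
  have hlenu := (hadj u).1.length_le_card
  have hlenv := (hadj v).1.length_le_card
  rw [Fintype.card_fin] at hlenu hlenv
  have hc : ∀ (f : Fin n → Fin n) y, ((adj u).map f).count y ≤ n := fun f y =>
    (List.count_le_length.trans_eq (List.length_map _)).trans hlenu
  have hfle : ∀ y, f y ≤ 2 * n := by
    intro y
    have h1 := hc P y
    have h2 := hc P' y
    simp only [hf]
    split_ifs <;> omega
  -- The term 2n² of the word bound accommodates this sum: at most n terms, each at most 2n.
  have hsum : ∀ l : List (Fin n), l.length ≤ n → (l.map f).sum ≤ 2 * n * n := by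
    intro l hl
    refine (List.sum_le_card_nsmul _ (2 * n) ?_).trans ?_
    · intro k hk
      obtain ⟨y, -, rfl⟩ := List.mem_map.mp hk
      exact hfle y
    · rw [List.length_map, smul_eq_mul, mul_comm]
      exact Nat.mul_le_mul_left _ hl
  refine (Ends.forNbr hs (fun l s' => s'.reg 11 = (l.map f).sum) 25 v hv rfl ?_ ?_ ?_).mono
    (by omega) ?_
  · intro l s' k hI
    exact ⟨by simpa [State.setReg] using hI, by simpa [State.setReg] using hI⟩
  · intro pre x post s' hpre hfr hs' hy hx hI
    have h5 : s'.arr 5 = s.arr 5 := hfr.2 5 rfl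
    have h9 : s'.arr 9 = s.arr 9 := hfr.2 9 rfl
    have h10 : s'.arr 10 = s.arr 10 := hfr.2 10 rfl
    have h11' : s'.arr 11 = s.arr 11 := hfr.2 11 rfl
    have hxn := x.2
    have h5x := hT.le_five x
    have h9x := hT.le_nine (s.arr 5 x)
    have hs2 := hsum (pre ++ [x]) (by
      have := congrArg List.length hpre
      simp only [List.length_append, List.length_cons] at this ⊢
      simp only [List.length_nil]
      omega)
    have hc1 := hc P x
    have hc2 := hc P' x
    have hsx : ((pre ++ [x]).map f).sum = (pre.map f).sum + f x := by simp
    refine Ends.of_wp ?_ (by decide)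
    by_cases hB : s.arr 9 (s.arr 5 x) = v + 1
    · have hfx : f x = ((adj u).map P).count x := by simp [hf, hB]
      rw [hsx, hfx] at hs2
      simp only [Prog.wp, Test.Fits, Test.Holds, Expr.Fits, Expr.val, State.setReg, hx, hy, hI, h5,
        h9, h10, h11', (hcnt x).1, (hcnt x).2, Function.update_self, ne_eq, Nat.reduceEqDiff,
        not_false_eq_true, Function.update_of_ne, hsx, hfx, hB]
      exact ⟨by omega, by omega, fun _ => trivial, fun h => absurd trivial h⟩
    · have hfx : f x = ((adj u).map P).count x + ((adj u).map P').count x := by simp [hf, hB]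
      rw [hsx, hfx] at hs2
      simp only [Prog.wp, Test.Fits, Test.Holds, Expr.Fits, Expr.val, State.setReg, hx, hy, hI, h5,
        h9, h10, h11', (hcnt x).1, (hcnt x).2, Function.update_self, ne_eq, Nat.reduceEqDiff,
        not_false_eq_true, Function.update_of_ne, hsx, hfx, hB]
      exact ⟨by omega, by omega, fun h => absurd h id, fun _ => ⟨by omega, by omega⟩⟩
  · simpa using h11
  · intro s' h
    rw [h, sum_count_add_eq_countP (adj u) (adj v) (hadj v).1 P P'
      (fun y => s.arr 9 (s.arr 5 y) = v + 1) ?_]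
    · simp only [(hadj v).2]
    · intro x hx
      rw [hP x (((hadj u).2 x).mp hx), hst, (hadj v).2]

theorem Ends.check {P P' : Fin n → Fin n} (hadj : IsAdjLists G adj) (hs : Holds W adj u s)
    (hT : Tidy G s) (hP : ∀ x, G.Adj u x → s.arr 5 (P' x) = P x)
    (hcnt : ∀ y : Fin n, s.arr 10 y = ((adj u).map P).count y ∧
        s.arr 11 y = ((adj u).map P').count y) :
    Ends W SearchDiam.check s (∑ v, (56 * (adj v).length + 43) + 5) fun s' =>
      Tidy G s' ∧ ∀ v : Fin n,
        ((∀ x, G.Adj u x → G.Adj v (P x) ∨ G.Adj v (P' x)) → s'.arr 8 v = 1) ∧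
        ((¬ ∀ x, G.Adj u x → G.Adj v (P x) ∨ G.Adj v (P' x)) → s'.arr 8 v = s.arr 8 v) := by
  classical
  have hbd := hs.bound
  have hnn : 0 ≤ 2 * n * n := Nat.zero_le _
  refine (Ends.forBelow (fun j s' => Tidy G s' ∧ ∀ v : Fin n,
    ((v : ℕ) < j → (∀ x, G.Adj u x → G.Adj v (P x) ∨ G.Adj v (P' x)) → s'.arr 8 v = 1) ∧
        (j ≤ v ∨ (¬ ∀ x, G.Adj u x → G.Adj v (P x) ∨ G.Adj v (P' x)) → s'.arr 8 v = s.arr 8 v))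
    (fun v => (18 * (adj v).length + 9) + (2 + ((38 * (adj v).length + 9) + 16)))
    hs.reg_zero (by omega) (by decide) rfl rfl (fun j s' k h => ?_) ?_
    ⟨hT, fun v => ⟨fun h => by omega, fun _ => rfl⟩⟩).mono ?_ ?_
  · exact ⟨⟨h.1.1, h.1.2, h.1.3, h.1.4⟩, h.2⟩
  · rintro v s₁ hf₁ ⟨hT₁, hI⟩ hv
    have hvn := v.2
    have hs₁ := hs.of_frame hf₁ rfl
    refine Ends.seq (Ends.stamp hadj hs₁ hT₁ hv (by decide) (by decide)) ?_
    rintro s₂ ⟨hT₂, hst⟩ hf₂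
    have h1 : Ends W (.setReg 11 (.lit 0)) s₂ 2 fun s' => s'.reg 11 = 0 :=
      Ends.of_wp ⟨by simp only [Expr.Fits]; omega, by simp [State.setReg, Expr.val]⟩ (by decide)
    refine h1.seq fun s₃ h11 hf₃ => ?_
    have hs₃ := (hs₁.of_frame hf₂ rfl).of_frame hf₃ rfl
    have hv₃ : s₃.reg 13 = v := by rw [hf₃.1 13 rfl, hf₂.1 13 rfl, hv]
    refine Ends.seq (Ends.countHit hadj hs₃ (hT₂.of_frame hf₃ rfl) hv₃ h11 (P := P) (P' := P')
      ?_ ?_ ?_) ?_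
    · rw [hf₃.2 5 rfl, hf₂.2 5 rfl, hf₁.2 5 rfl]
      exact hP
    · rw [hf₃.2 10 rfl, hf₂.2 10 rfl, hf₁.2 10 rfl, hf₃.2 11 rfl, hf₂.2 11 rfl, hf₁.2 11 rfl]
      exact hcnt
    · rw [hf₃.2 9 rfl]
      exact hst
    intro s₄ h11' hf₄
    have hs₄ := hs₃.of_frame hf₄ rfl
    have hT₄ := (hT₂.of_frame hf₃ rfl).of_frame hf₄ rfl
    have hv₄ : s₄.reg 13 = v := (hf₄.1 13 rfl).trans hv₃
    have h8 : s₄.arr 8 = s₁.arr 8 := by rw [hf₄.2 8 rfl, hf₃.2 8 rfl, hf₂.2 8 rfl]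
    have hle1 := hs.offset_le (u + 1) u.2
    have hle := List.countP_le_length (p := fun x => decide (G.Adj v (P x) ∨ G.Adj v (P' x)))
      (l := adj u)
    have hnn2 : 2 * n * n = n * n + n * n := by ring
    have hun := u.2
    have hT₅ : Tidy G (s₄.setArr 8 v 1) := ⟨hT₄.1, hT₄.2, hT₄.3, hT₄.4⟩
    rw [offset_succ] at hle1
    -- The program compares the count with the degree of u, the difference of two consecutive
    -- boundaries.
    have hall : (adj u).countP (fun x => decide (G.Adj v (P x) ∨ G.Adj v (P' x))) =
        (adj u).length ↔ ∀ x, G.Adj u x → G.Adj v (P x) ∨ G.Adj v (P' x) := by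
      rw [List.countP_eq_length]
      simp only [decide_eq_true_eq, (hadj u).2]
    refine Ends.of_wp ?_ (by decide)
    simp only [Prog.wp, Test.Fits, Test.Holds, Expr.Fits, Expr.val, h11', hs₄.reg_one,
      hs₄.arr_zero (u + 1) u.2, hs₄.arr_zero u u.2.le, offset_succ, hv₄, Nat.add_sub_cancel_left,
      hall]
    refine ⟨by omega, fun hh => ⟨by omega, by omega, hT₅, fun y => ?_⟩,
      fun hh => ⟨hT₄, fun y => ?_⟩⟩
    · by_cases hy : y = v
      · subst hy
        refine ⟨fun _ _ => by simp [State.setArr], fun h => ?_⟩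
        rcases h with h | h
        · omega
        · exact absurd hh h
      · have hne : (y : ℕ) ≠ v := fun h => hy (Fin.ext h)
        simp only [State.setArr, Function.update_self, Function.update_of_ne hne, h8]
        exact ⟨fun h => (hI y).1 (by omega), fun h => (hI y).2 (h.imp_left fun h => by omega)⟩
    · rw [h8]
      by_cases hy : y = v
      · subst hy
        exact ⟨fun _ h => absurd h hh, fun _ => (hI y).2 (Or.inr hh)⟩
      · have hne : (y : ℕ) ≠ v := fun h => hy (Fin.ext h)
        exact ⟨fun h => (hI y).1 (by omega), fun h => (hI y).2 (h.imp_left fun h => by omega)⟩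
  · refine Nat.add_le_add_right (Finset.sum_le_sum fun v _ => ?_) _
    omega
  · rintro s' ⟨h1, h2⟩
    exact ⟨h1, fun v => ⟨(h2 v).1 v.2, fun h => (h2 v).2 (Or.inr h)⟩⟩

theorem dist_le_card (hc : G.Connected) (v w : Fin n) : G.dist v w ≤ n := by
  obtain ⟨p, hp, hl⟩ := hc.exists_path_of_dist v w
  have := hp.length_lt
  rw [Fintype.card_fin] at this
  omega

/-- Applied to v = z, the last alternative can only discard z, since z does not cover w. Every other
vertex at distance e is discarded or covers w. -/
theorem Ends.round {z : Fin n} {e : ℕ} (hG : IsPrime G) (hc : G.Connected)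
    (hadj : IsAdjLists G adj) (hs : Holds W adj u s) (hT : Tidy G s) (h5 : s.reg 5 = z)
    (h2 : s.reg 2 = e) (he : 2 ≤ e) (hz : G.dist u z = e) :
    Ends W SearchDiam.round s (∑ v, (361 * (adj v).length + 322)) fun s' => Tidy G s' ∧
      (∀ v : Fin n, s'.arr 8 v = 1 ∨ s'.arr 8 v = s.arr 8 v) ∧
      ∃ w : Fin n, IsExtremity G w ∧ ¬ Covers G u z w ∧
        ((∃ x, G.Adj u x ∧ e < G.dist w x ∧ s'.reg 3 = x ∧ s'.reg 4 = e + 1) ∨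
        (s'.reg 3 = s.reg 3 ∧ s'.reg 4 = s.reg 4 ∧ ∀ v : Fin n, G.dist u v = e →
          (s'.arr 8 v = 1 ∧ ∀ x, G.Adj u x → G.dist x v ≤ e) ∨
          (s'.arr 8 v = s.arr 8 v ∧ Covers G u v w))) := by
  have hn : 0 < n := u.pos
  have hzu : ¬ G.Adj z u := fun h => by
    rw [SimpleGraph.dist_eq_one_iff_adj.mpr h.symm] at hz
    omega
  have hne : z ≠ u := by
    rintro rfl
    rw [SimpleGraph.dist_self] at hz
    omega
  -- The additive constants 45 + 21 + 9 + 5 = 80 are charged to the vertices, of which there is at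
  -- least one: 133 + 66 + 43 + 80 = 322.
  have hsum : (∑ v, (176 * (adj v).length + 133) + 45) + ((∑ v, (79 * (adj v).length + 66) + 21) +
      ((50 * (adj u).length + 9) + (∑ v, (56 * (adj v).length + 43) + 5))) ≤
      ∑ v, (361 * (adj v).length + 322) := by
    have h1 : (adj u).length ≤ ∑ v, (adj v).length :=
      Finset.single_le_sum (f := fun v => (adj v).length) (fun _ _ => Nat.zero_le _)
        (Finset.mem_univ u)
    simp only [Finset.sum_add_distrib, ← Finset.mul_sum, Finset.sum_const, Finset.card_univ,
      Fintype.card_fin, smul_eq_mul]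
    omega
  refine (Ends.seq (Ends.findExtremity hG hadj hs hT h5 hzu hne) ?_).mono hsum fun _ h => h
  rintro s₁ ⟨hT₁, w, h12, hw, hcov⟩ hf₁
  have hs₁ := hs.of_frame hf₁ rfl
  have hne' : ∀ x, G.Adj u x → x ≠ w := by
    rintro x hx rfl
    exact hcov ⟨u, .refl, Or.inr hx⟩
  refine Ends.seq (Ends.bfs hc hadj hs₁ hT₁ h12 rfl (by decide)) ?_
  rintro s₂ ⟨hT₂, h0, hd, hlast⟩ hf₂
  have hs₂ := hs₁.of_frame hf₂ rfl
  have : ∀ x : Fin n, ∃ p p' : Fin n, G.Adj u x → s₂.arr 5 x = p ∧ s₂.arr 6 x = p' ∧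
      s₂.arr 5 p' = p ∧ Last G w x p p' := by
    intro x
    by_cases hx : G.Adj u x
    · obtain ⟨p, p', h⟩ := hlast x (hne' x hx)
      exact ⟨p, p', fun _ => h⟩
    · exact ⟨x, x, fun h => absurd h hx⟩
  choose P P' hPP using this
  refine Ends.seq (Ends.tally (P := P) (P' := P') hadj hs₂ (e := e) ?_ (hz ▸ dist_le_card hc u z) hd
    (dist_le_card hc w) (fun x hx => ⟨(hPP x hx).1, (hPP x hx).2.1⟩) h0) ?_
  · rw [hf₂.1 2 rfl, hf₁.1 2 rfl, h2]
  rintro s₃ ⟨hcnt, hres⟩ hf₃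
  have hs₃ := hs₂.of_frame hf₃ rfl
  refine (Ends.check hadj hs₃ (hT₂.of_frame hf₃ rfl) (fun x hx => ?_) hcnt).frame.mono le_rfl ?_
  · rw [hf₃.2 5 rfl]
    exact (hPP x hx).2.2.1
  rintro s₄ ⟨⟨hT₄, h8⟩, hf₄⟩
  have h8' : s₃.arr 8 = s.arr 8 := by rw [hf₃.2 8 rfl, hf₂.2 8 rfl, hf₁.2 8 rfl]
  rw [h8'] at h8
  refine ⟨hT₄, fun v => ?_, w, hw, hcov, ?_⟩
  · by_cases h : ∀ x, G.Adj u x → G.Adj v (P x) ∨ G.Adj v (P' x)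
    · exact Or.inl ((h8 v).1 h)
    · exact Or.inr ((h8 v).2 h)
  · rw [hf₄.1 3 rfl, hf₄.1 4 rfl]
    refine hres.imp (fun h => h) fun ⟨h1, h3, h4⟩ => ⟨?_, ?_, fun v hv => ?_⟩
    · rw [h3, hf₂.1 3 rfl, hf₁.1 3 rfl]
    · rw [h4, hf₂.1 4 rfl, hf₁.1 4 rfl]
    · by_cases h : ∀ x, G.Adj u x → G.Adj v (P x) ∨ G.Adj v (P' x)
      · exact Or.inl ⟨(h8 v).1 h, fun x hx =>
          (hPP x hx).2.2.2.dist_le_of_adj hc (by omega) (h1 x hx) (h x hx)⟩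
      · refine Or.inr ⟨(h8 v).2 h, ?_⟩
        push Not at h
        obtain ⟨x, hx, hp, hp'⟩ := h
        exact (hPP x hx).2.2.2.covers hc hx hv (h1 x hx) hp hp'

end

section

variable {n W : ℕ} {G : SimpleGraph (Fin n)} {adj : Fin n → List (Fin n)} {u : Fin n} {s : State}

/-! ### The main program -/

/-- Copy the distances to array `7` and compute their maximum. -/
def eccentricity : Prog :=
  forBelow 13 (.seq (.setArr 7 (.reg 13) (.read 4 (.reg 13)))
    (.cond (.lt (.reg 2) (.read 4 (.reg 13))) (.setReg 2 (.read 4 (.reg 13))) .nop))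

/-- The loop over the vertices at maximum distance from the given vertex. -/
def mainLoop : Prog :=
  .loop (.lt (.reg 5) (.reg 0)) (.seq
    (.cond (.and (.lt (.lit 1) (.reg 2)) (.and (.eq (.read 7 (.reg 5)) (.reg 2))
      (.and (.eq (.read 8 (.reg 5)) (.lit 0)) (.eq (.reg 4) (.reg 2))))) round .nop)
    (.setReg 5 (.add (.reg 5) (.lit 1))))

/-- Compute the largest eccentricity in the closed neighbourhood of a vertex. -/
def ellProg : Prog :=
  .seq (bfs 1) (.seq eccentricity (.seq
    (.seq (.setReg 4 (.reg 2)) (.setReg 3 (.reg 1))) (.seq mainLoop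
      (.seq (.setReg 0 (.reg 4)) (.setReg 1 (.reg 3))))))

theorem Ends.eccentricity (hs : Holds W adj u s) (h2 : s.reg 2 = 0)
    (hd : ∀ v : Fin n, s.arr 4 v = G.dist u v) (hdn : ∀ v, G.dist u v ≤ n) :
    Ends W SearchDiam.eccentricity s (22 * n + 5) fun s' =>
      (∀ v : Fin n, s'.arr 7 v = G.dist u v ∧ G.dist u v ≤ s'.reg 2) ∧
        ∃ v, s'.reg 2 = G.dist u v := by
  have hbd := hs.bound
  have hnn : 0 ≤ 2 * n * n := Nat.zero_le _
  refine (Ends.forBelow (fun j s' => (∀ v : Fin n, (v : ℕ) < j →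
      s'.arr 7 v = G.dist u v ∧ G.dist u v ≤ s'.reg 2) ∧ ∃ v, s'.reg 2 = G.dist u v)
    (fun _ => 15) hs.reg_zero (by omega) (by decide) rfl rfl ?_ ?_ ?_).mono (by simp; omega) ?_
  · intro j s' k h
    simpa [State.setReg] using h
  · rintro j s' hf ⟨hI, v, hv⟩ hj
    have hjn := j.2
    have h4 : s'.arr 4 = s.arr 4 := hf.2 4 rfl
    have h1 := hdn j
    have h2 := hdn v
    refine Ends.of_wp ?_ (by decide)
    simp only [Prog.wp, Test.Fits, Test.Holds, Expr.Fits, Expr.val, State.setReg, State.setArr, hj,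
      h4, hd, Function.update_self, ne_eq, Nat.reduceEqDiff, not_false_eq_true,
      Function.update_of_ne]
    refine ⟨by omega, by omega, by omega, fun hlt => ⟨by omega, fun x hx => ?_, j, rfl⟩,
      fun hge => ⟨fun x hx => ?_, v, hv⟩⟩
    · by_cases h : x = j
      · simp [h]
      · have hne : (x : ℕ) ≠ j := fun h' => h (Fin.ext h')
        have := hI x (by omega)
        rw [Function.update_of_ne hne]
        exact ⟨this.1, by omega⟩
    · by_cases h : x = j
      · rw [h, Function.update_self]
        exact ⟨rfl, by omega⟩
      · have hne : (x : ℕ) ≠ j := fun h' => h (Fin.ext h')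
        rw [Function.update_of_ne hne]
        exact hI x (by omega)
  · exact ⟨by simp, u, by simp [h2]⟩
  · exact fun s' h => ⟨fun v => h.1 v v.2, h.2⟩

/-- The invariant of the main loop. The extremities in `F` have been used, and the vertices below
`j` have been dealt with. -/
structure Progress (G : SimpleGraph (Fin n)) (u : Fin n) (e : ℕ) (j : ℕ) (F : Finset (Fin n))
    (s : State) : Prop where
  reg_five : s.reg 5 = j
  le : j ≤ n
  tidy : Tidy G s
  extremity : ∀ w ∈ F, IsExtremity G w
  le_one : ∀ v : Fin n, s.arr 8 v ≤ 1
  state : (s.reg 4 = e ∧ s.reg 3 = u ∧ (2 ≤ e → ∀ v : Fin n, G.dist u v = e →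
      (s.arr 8 v = 1 ∧ ∀ x, G.Adj u x → G.dist x v ≤ e) ∨
      (s.arr 8 v = 0 ∧ j ≤ v ∧ ∀ w ∈ F, Covers G u v w))) ∨
    (s.reg 4 = e + 1 ∧ ∃ x : Fin n, s.reg 3 = x ∧ G.Adj u x ∧ ∃ w, e < G.dist x w)

theorem Ends.mainLoop {e : ℕ} (hG : IsPrime G) (hc : G.Connected)
    (hadj : IsAdjLists G adj) (hs : Holds W adj u s) (h2 : s.reg 2 = e) (hen : e ≤ n)
    (h7 : ∀ v : Fin n, s.arr 7 v = G.dist u v) (h₀ : Progress G u e 0 ∅ s) :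
    Ends W SearchDiam.mainLoop s
      (n * 30 + numExtremities G * (∑ v, (361 * (adj v).length + 322)) + 3) fun s' =>
      ∃ F, Progress G u e n F s' := by
  have hbd := hs.bound
  have hnn : 0 ≤ 2 * n * n := Nat.zero_le _
  set R := ∑ v, (361 * (adj v).length + 322) with hR
  have hcard : ∀ F : Finset (Fin n), (∀ w ∈ F, IsExtremity G w) → F.card ≤ numExtremities G := by
    intro F hF
    rw [numExtremities, ← Set.ncard_coe_finset]
    exact Set.ncard_le_ncard (fun w hw => hF w hw) (Set.toFinite _)
  have key := Ends.loop (W := W) (b := .lt (.reg 5) (.reg 0))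
    (p := .seq (.cond (.and (.lt (.lit 1) (.reg 2)) (.and (.eq (.read 7 (.reg 5)) (.reg 2))
      (.and (.eq (.read 8 (.reg 5)) (.lit 0)) (.eq (.reg 4) (.reg 2))))) SearchDiam.round .nop)
      (.setReg 5 (.add (.reg 5) (.lit 1)))) (s₀ := s)
    (fun (g : ℕ × Finset (Fin n)) s => Progress G u e g.1 g.2 s)
    -- Each vertex pays for its own tests, and each round is paid by the extremity that it adds to
    -- F.
    (fun g => (n - g.1) * 30 + (numExtremities G - g.2.card) * R) (0, ∅) ?_ h₀
  · refine key.frame.mono (by simp [Test.cost, Expr.cost]) ?_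
    rintro s' ⟨⟨⟨j, F⟩, hI, hb⟩, hf⟩
    have hs' := hs.of_frame hf rfl
    simp only [Test.Holds, Expr.val, hI.reg_five, hs'.reg_zero] at hb
    have hle := hI.le
    have : j = n := by
      simp only at hle
      omega
    exact ⟨F, this ▸ hI⟩
  · rintro ⟨j, F⟩ s₁ hf hI
    simp only at hI
    have hs₁ := hs.of_frame hf rfl
    have hle := hI.le
    have h2₁ : s₁.reg 2 = e := (hf.1 2 rfl).trans h2
    refine ⟨by simp only [Test.Fits, Expr.Fits, hI.reg_five, hs₁.reg_zero]; omega, fun hb => ?_⟩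
    simp only [Test.Holds, Expr.val, hI.reg_five, hs₁.reg_zero] at hb
    obtain ⟨z, hzj⟩ : ∃ z : Fin n, (z : ℕ) = j := ⟨⟨j, hb⟩, rfl⟩
    have h5 : s₁.reg 5 = z := hI.reg_five.trans hzj.symm
    have h7z : s₁.arr 7 z = G.dist u z := by rw [hf.2 7 rfl, h7]
    have hzn := dist_le_card hc u z
    have h8z := hI.le_one z
    have h4 : s₁.reg 4 ≤ e + 1 := by
      rcases hI.state with h | h <;> omega
    have hstep : ∀ T, Ends W (.cond (.and (.lt (.lit 1) (.reg 2)) (.and (.eq (.read 7 (.reg 5))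
        (.reg 2)) (.and (.eq (.read 8 (.reg 5)) (.lit 0)) (.eq (.reg 4) (.reg 2)))))
        SearchDiam.round .nop) s₁ T (fun s' => ∃ F', Progress G u e j F' s' ∧
          (∀ v : Fin n, (v : ℕ) = j → s'.reg 4 = e → 2 ≤ e → G.dist u v = e → s'.arr 8 v = 1) ∧
          T + (numExtremities G - F'.card) * R ≤ 23 + (numExtremities G - F.card) * R) →
        ∃ T, Ends W (.seq (.cond (.and (.lt (.lit 1) (.reg 2)) (.and (.eq (.read 7 (.reg 5))
          (.reg 2)) (.and (.eq (.read 8 (.reg 5)) (.lit 0)) (.eq (.reg 4) (.reg 2)))))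
          SearchDiam.round .nop) (.setReg 5 (.add (.reg 5) (.lit 1)))) s₁ T fun s' =>
          ∃ g' : ℕ × Finset (Fin n), Progress G u e g'.1 g'.2 s' ∧
            T + (Test.lt (.reg 5) (.reg 0)).cost +
            ((n - g'.1) * 30 + (numExtremities G - g'.2.card) * R) ≤
            (n - (j, F).1) * 30 + (numExtremities G - (j, F).2.card) * R := by
      intro T hT
      refine ⟨T + 4, Ends.seq hT ?_⟩
      rintro s₂ ⟨F', hI', hz, htime⟩ -
      refine Ends.of_wp ⟨?_, (j + 1, F'), ?_, ?_⟩ (by decide)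
      · simp only [Expr.Fits, Expr.val, hI'.reg_five]
        omega
      · refine ⟨by simp [State.setReg, Expr.val, hI'.reg_five], hb,
          ⟨hI'.tidy.1, hI'.tidy.2, hI'.tidy.3, hI'.tidy.4⟩, hI'.extremity, hI'.le_one, ?_⟩
        refine hI'.state.imp (fun ⟨h1, h2, h3⟩ => ⟨h1, h2, fun he v hv => ?_⟩) fun h => h
        rcases h3 he v hv with h | ⟨h, hjv, hF⟩
        · exact Or.inl h
        · refine Or.inr ⟨h, ?_, hF⟩
          by_contra hcon
          have := hz v (by omega) h1 he hv
          omega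
      · have : n - j = (n - (j + 1)) + 1 := by omega
        simp only [Test.cost, Expr.cost]
        omega
    by_cases hh : Test.Holds s₁ (.and (.lt (.lit 1) (.reg 2)) (.and (.eq (.read 7 (.reg 5))
        (.reg 2)) (.and (.eq (.read 8 (.reg 5)) (.lit 0)) (.eq (.reg 4) (.reg 2)))))
    · refine hstep (17 + R) (Ends.cond ?_ (fun _ => ?_) (fun h => absurd hh h))
      · simp only [Test.Fits, Expr.Fits, Expr.val, h5, h2₁, h7z]
        omega
      simp only [Test.Holds, Expr.val, h5, h2₁, h7z] at hh
      obtain ⟨he, hze, h8, h4e⟩ := hh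
      refine (Ends.round hG hc hadj hs₁ hI.tidy h5 h2₁ he hze).frame.mono le_rfl ?_
      rintro s₂ ⟨⟨hT₂, h8₂, w, hw, hcov, hres⟩, hf₂⟩
      have hold : ∀ v : Fin n, G.dist u v = e →
          (s₁.arr 8 v = 1 ∧ ∀ x, G.Adj u x → G.dist x v ≤ e) ∨
          (s₁.arr 8 v = 0 ∧ j ≤ v ∧ ∀ w ∈ F, Covers G u v w) := by
        rcases hI.state with h | h
        · exact h.2.2 he
        · omega
      -- The undiscarded vertex z covers all extremities used before, but not w.
      have hwF : w ∉ F := by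
        intro hwF
        rcases hold z hze with h | h
        · omega
        · exact hcov (h.2.2 w hwF)
      have hext : ∀ x ∈ insert w F, IsExtremity G x := by
        intro x hx
        rcases Finset.mem_insert.mp hx with rfl | hx
        · exact hw
        · exact hI.extremity x hx
      have hlt := hcard _ hext
      rw [Finset.card_insert_of_notMem hwF] at hlt
      refine ⟨insert w F, ⟨(hf₂.1 5 rfl).trans hI.reg_five, hle, hT₂, hext, fun v => ?_, ?_⟩, ?_, ?_⟩
      · rcases h8₂ v with h | h
        · omega
        · exact h ▸ hI.le_one v
      · rcases hres with ⟨x, hx, hwx, h3, h4⟩ | ⟨h3, h4, h⟩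
        · exact Or.inr ⟨h4, x, h3, hx, w, by rwa [SimpleGraph.dist_comm]⟩
        · refine Or.inl ⟨h4.trans h4e, ?_, fun _ v hv => ?_⟩
          · rw [h3]
            rcases hI.state with h | h
            · exact h.2.1
            · omega
          · rcases h v hv with h | ⟨h, hcv⟩
            · exact Or.inl h
            · rcases hold v hv with h' | h'
              · exact Or.inl ⟨h.trans h'.1, h'.2⟩
              · refine Or.inr ⟨h.trans h'.1, h'.2.1, fun x hx => ?_⟩
                rcases Finset.mem_insert.mp hx with rfl | hx
                · exact hcv
                · exact h'.2.2 x hx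
      · intro v hv h4' _ _
        obtain rfl : v = z := Fin.ext (hv.trans hzj.symm)
        rcases hres with ⟨x, hx, hwx, h3, h4⟩ | ⟨h3, h4, h⟩
        · omega
        · exact (h v hze).elim (fun h => h.1) fun h => absurd h.2 hcov
      · rw [Finset.card_insert_of_notMem hwF]
        have : numExtremities G - F.card = (numExtremities G - (F.card + 1)) + 1 := by omega
        rw [this, Nat.add_mul, Nat.one_mul]
        omega
    · refine hstep 18 (Ends.cond (T := 1) ?_ (fun h => absurd h hh) fun _ =>
        Ends.of_wp (p := .nop) ?_ (by decide))
      · simp only [Test.Fits, Expr.Fits, Expr.val, h5, h2₁, h7z]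
        omega
      · refine ⟨F, hI, fun v hv h4' he hv' => ?_, by omega⟩
        obtain rfl : v = z := Fin.ext (hv.trans hzj.symm)
        rcases Nat.lt_or_ge (s₁.arr 8 v) 1 with h | h
        · refine absurd ?_ hh
          simp only [Test.Holds, Expr.val, h5, h2₁, h7z]
          omega
        · omega

/-! ### Correctness and running time of the whole program -/

theorem sum_length_eq (hadj : IsAdjLists G adj) : ∑ v, (adj v).length = 2 * numEdges G := by
  classical
  rw [numEdges, ← SimpleGraph.coe_edgeFinset, Set.ncard_coe_finset,
    ← G.sum_degrees_eq_twice_card_edges]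
  refine Finset.sum_congr rfl fun v _ => ?_
  rw [← List.toFinset_card_of_nodup (hadj v).1, SimpleGraph.degree]
  congr 1
  ext w
  simp [(hadj v).2]

theorem tidy_inputState : Tidy G (inputState adj u) := by
  refine ⟨?_, ?_, ?_, ?_⟩ <;> simp [inputState]

theorem ends_ellProg (hG : IsPrime G) (hc : G.Connected) (hadj : IsAdjLists G adj)
    (hW : 2 * n * n + 4 * n + 8 < W) :
    Ends W ellProg (inputState adj u) (1800 * max 1 (numExtremities G * numEdges G)) fun s' =>
      (s'.reg 0 : ℕ∞) = ell G u ∧ ∃ x : Fin n, s'.reg 1 = x ∧ x ∈ closedNbhd G u ∧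
        G.eccent x = ell G u := by
  have hs := holds_inputState hadj u hW
  have hnn : 0 ≤ 2 * n * n := Nat.zero_le _
  have hun := u.2
  -- For m ≥ 1 one has n ≤ 2m, and the total is at most 1366qm + 431m, where m ≤ qm. For m = 0 there
  -- is one vertex.
  have htime : (∑ v, (79 * (adj v).length + 66) + 21) + ((22 * n + 5) + (4 +
      ((n * 30 + numExtremities G * (∑ v, (361 * (adj v).length + 322)) + 3) + 4))) ≤
      1800 * max 1 (numExtremities G * numEdges G) := by
    simp only [Finset.sum_add_distrib, ← Finset.mul_sum, Finset.sum_const, Finset.card_univ,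
      Fintype.card_fin, smul_eq_mul, sum_length_eq hadj]
    have hnm : n ≤ numEdges G + 1 := by
      have := hc.card_vert_le_card_edgeSet_add_one
      rwa [Nat.card_coe_set_eq, Nat.card_eq_fintype_card, Fintype.card_fin] at this
    have hq1 : 1 ≤ numExtremities G := by
      obtain ⟨w, hw⟩ := exists_isExtremity hG u
      exact (Set.ncard_pos (Set.toFinite _)).mpr ⟨w, hw⟩
    have hqn : numExtremities G ≤ n := by
      have := Set.ncard_le_card {v | IsExtremity G v}
      rwa [Nat.card_eq_fintype_card, Fintype.card_fin] at this
    generalize numExtremities G = q at *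
    generalize numEdges G = m at *
    rcases Nat.eq_zero_or_pos m with rfl | hm
    · have : n = 1 := by omega
      have : q = 1 := by omega
      subst_vars
      decide
    · have h1 : 722 * (q * m) + 322 * (q * n) ≤ 1366 * (q * m) := by
        have : q * n ≤ q * (2 * m) := Nat.mul_le_mul_left _ (by omega)
        have h2 : q * (2 * m) = 2 * (q * m) := by ring
        omega
      have h3 : m ≤ q * m := Nat.le_mul_of_pos_left m hq1
      have h4 : q * (361 * (2 * m) + n * 322) = 722 * (q * m) + 322 * (q * n) := by ring
      rw [h4]
      have h5 := le_max_right 1 (q * m)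
      omega
  refine Ends.mono (Ends.seq (Ends.bfs hc hadj hs tidy_inputState hs.reg_one rfl (by decide)) ?_)
    htime fun _ h => h
  rintro s₁ ⟨hT₁, -, hd, -⟩ hf₁
  have hs₁ := hs.of_frame hf₁ rfl
  refine Ends.seq (Ends.eccentricity hs₁ (by rw [hf₁.1 2 rfl]; rfl) hd (dist_le_card hc u)) ?_
  rintro s₂ ⟨h7, y, hy⟩ hf₂
  have hs₂ := hs₁.of_frame hf₂ rfl
  have hen : s₂.reg 2 ≤ n := hy ▸ dist_le_card hc u y
  obtain ⟨e, he⟩ : ∃ e, s₂.reg 2 = e := ⟨_, rfl⟩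
  rw [he] at hen hy h7
  refine Ends.seq (T := 4) (R := fun s' => s'.reg 4 = e ∧ s'.reg 3 = u) (Ends.of_wp ?_ (by decide))
    ?_
  · simp only [Prog.wp, Expr.Fits, Expr.val, State.setReg, he, ne_eq, Nat.reduceEqDiff,
      not_false_eq_true, Function.update_of_ne, Function.update_self, hs₂.reg_one,
      OfNat.one_ne_ofNat]
    exact ⟨by omega, by omega, trivial, trivial⟩
  rintro s₃ ⟨h4, h3⟩ hf₃
  have hs₃ := hs₂.of_frame hf₃ rfl
  have h8 : ∀ v : Fin n, s₃.arr 8 v = 0 := by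
    intro v
    rw [hf₃.2 8 rfl, hf₂.2 8 rfl, hf₁.2 8 rfl]
    rfl
  refine Ends.seq (Ends.mainLoop hG hc hadj hs₃ (e := e) ?_ hen ?_ ?_) ?_
  · rw [hf₃.1 2 rfl, he]
  · rw [hf₃.2 7 rfl]
    exact fun v => (h7 v).1
  · refine ⟨?_, Nat.zero_le _, (hT₁.of_frame hf₂ rfl).of_frame hf₃ rfl, by simp, fun v => ?_,
      Or.inl ⟨h4, h3, fun _ v _ => Or.inr ⟨h8 v, Nat.zero_le _, by simp⟩⟩⟩
    · rw [hf₃.1 5 rfl, hf₂.1 5 rfl, hf₁.1 5 rfl]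
      rfl
    · rw [h8]
      exact Nat.zero_le _
  rintro s₄ ⟨F, hI⟩ -
  -- Moving from u to a neighbour raises the eccentricity by at most one, so a single pair at
  -- distance e + 1 settles the maximum.
  have hbdist : ∀ x ∈ closedNbhd G u, ∀ w, G.dist x w ≤ e + 1 := by
    rintro x (rfl | hx) w
    · exact (h7 w).2.trans (Nat.le_succ e)
    · have h1 := dist_le_succ_of_adj hc (a := w) hx
      rw [SimpleGraph.dist_comm, SimpleGraph.dist_comm (u := w)] at h1
      have := (h7 w).2
      omega
  obtain ⟨k, x, hk4, hx3, hx, hell, hecc⟩ : ∃ (k : ℕ) (x : Fin n), s₄.reg 4 = k ∧ s₄.reg 3 = x ∧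
      x ∈ closedNbhd G u ∧ (k : ℕ∞) = ell G u ∧ G.eccent x = ell G u := by
    rcases hI.state with ⟨h4, h3, h⟩ | ⟨h4, x, h3, hx, w, hw⟩
    · refine ⟨e, u, h4, h3, Or.inl rfl, ell_eq_of_mem hc (Or.inl rfl) hy.le ?_⟩
      rintro x (rfl | hx) w
      · exact (h7 w).2
      · rcases Nat.lt_or_ge e 2 with he2 | he2
        -- For e ≤ 1 the main loop performs no round, and the answer e rests on primality.
        · have h1 := dist_le_one_of_universal hG hc (u := u) (fun v => (h7 v).2.trans (by omega)) x w
          rcases Nat.eq_zero_or_pos e with h0 | h0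
          · have := (h7 x).2
            rw [SimpleGraph.dist_eq_one_iff_adj.mpr hx] at this
            omega
          · omega
        · rcases Nat.lt_or_ge (G.dist u w) e with hlt | hge
          · have h1 := dist_le_succ_of_adj hc (a := w) hx
            rw [SimpleGraph.dist_comm, SimpleGraph.dist_comm (u := w)] at h1
            omega
          · rcases h he2 w (le_antisymm (h7 w).2 hge) with h | h
            · exact h.2 x hx
            · have := w.2
              omega
    · exact ⟨e + 1, x, h4, h3, Or.inr hx, ell_eq_of_mem hc (Or.inr hx) hw hbdist⟩
  have hkW : k < W := by
    rcases hI.state with h | h <;> omega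
  have hxn := x.2
  refine Ends.of_wp ?_ (by decide)
  simp only [Prog.wp, Expr.Fits, Expr.val, State.setReg, hk4, hx3, ne_eq, Function.update_self,
    OfNat.ofNat_ne_zero, not_false_eq_true, Function.update_of_ne, zero_ne_one]
  exact ⟨hkW, by omega, hell, x, rfl, hx, hecc⟩

end

end SearchDiam

theorem mainTheorem5 :
    ∃ (prog : SearchDiam.Prog) (k C : ℕ),
      ∀ (n : ℕ) (G : SimpleGraph (Fin n)) (adj : Fin n → List (Fin n)) (u : Fin n),
        G.Connected → SearchDiam.IsPrime G → SearchDiam.IsAdjLists G adj →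
        ∃ (t : ℕ) (s : SearchDiam.State),
          SearchDiam.Run ((n + 2) ^ k) prog (SearchDiam.inputState adj u) t s ∧
          (s.reg 0 : ℕ∞) = SearchDiam.ell G u ∧
          (∃ x : Fin n, s.reg 1 = (x : ℕ) ∧ x ∈ SearchDiam.closedNbhd G u ∧
            G.eccent x = SearchDiam.ell G u) ∧
          t ≤ C * max 1 (SearchDiam.numExtremities G * SearchDiam.numEdges G) ∧
          ∀ α : ℕ, SearchDiam.InExt α G →
            (t : ℝ) ≤ C * max 1 ((α : ℝ) * (SearchDiam.numEdges G : ℝ) ^ (3 / 2 : ℝ)) := by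
  -- Cubic word bounds suffice: (n + 2)³ exceeds 2n² + 4n + 8 for n ≥ 1. The constant 7200 is 1800
  -- times the factor 4 from q ≤ 4α√m.
  refine ⟨SearchDiam.ellProg, 3, 7200, fun n G adj u hc hG hadj => ?_⟩
  have hn := u.pos
  obtain ⟨t, s, hrun, ht, hell, hx⟩ := SearchDiam.ends_ellProg (W := (n + 2) ^ 3) (u := u) hG hc hadj
    (by nlinarith [Nat.mul_le_mul hn hn, Nat.zero_le (n * n * n)])
  refine ⟨t, s, hrun, hell, hx, ht.trans (Nat.mul_le_mul_right _ (by norm_num)), fun α hα => ?_⟩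
  have h1 : (t : ℝ) ≤ 1800 * max 1 (SearchDiam.numExtremities G * SearchDiam.numEdges G : ℕ) := by
    exact_mod_cast ht
  have h2 := hα.numExtremities_mul_le hG
  have h3 : max (1 : ℝ) (SearchDiam.numExtremities G * SearchDiam.numEdges G : ℕ) ≤
      4 * max 1 ((α : ℝ) * (SearchDiam.numEdges G : ℝ) ^ (3 / 2 : ℝ)) := by
    refine max_le ?_ (h2.trans ?_)
    · linarith [le_max_left 1 ((α : ℝ) * (SearchDiam.numEdges G : ℝ) ^ (3 / 2 : ℝ))]
    · linarith [le_max_right 1 ((α : ℝ) * (SearchDiam.numEdges G : ℝ) ^ (3 / 2 : ℝ))]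
  push_cast at h1 h3 ⊢
  linarith
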